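/- Let $\mathcal G=(G^0,\mathcal G^1,r,s)$ be an ultragraph, i.e. $G^0,\mathcal G^1$ are countable sets, $s:\mathcal G^1\to G^0$ and $r:\mathcal G^1\to P(G^0)\setminus\{\emptyset\}$ are maps, and let $R$ be a unital commutative ring. Let $\mathcal G^0\subseteq P(G^0)$ be the smallest collection containing $\emptyset$, all $\{v\}$ and all $r(e)$ that is closed under finite unions and (non-empty) finite intersections. The Leavitt path algebra $L_R(\mathcal G)$ is the universal (not necessarily unital) associative $R$-algebra with generators $s_e,s_e^*$ ($e\in\mathcal G^1$), $p_A$ ($A\in\mathcal G^0$) and relations (1) $p_\emptyset=0$, $p_Ap_B=p_{A\cap B}$, $p_{A\cup B}=p_A+p_B-p_{A\cap B}$; (2) $p_{\{s(e)\}}s_e=s_ep_{r(e)}=s_e$ and $p_{r(e)}s_e^*=s_e^*p_{\{s(e)\}}=s_e^*$; (3) $s_e^*s_f=\delta_{e,f}\,p_{r(e)}$; (4) $p_{\{v\}}=\sum_{s(e)=v}s_es_e^*$ whenever $0<|s^{-1}(v)|<\infty$. Let $W$ be the set of finite paths $a=a_1\cdots a_n$, $n\ge 1$, $a_i\in\mathcal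 G^1$, $s(a_{i+1})\in r(a_i)$, and put $r(a)=r(a_n)$, $s(a)=s(a_1)$. A sink is a vertex $v$ with $s^{-1}(v)=\emptyset$. Let $X$ be the set of all infinite paths $e_1e_2\cdots$ ($s(e_{i+1})\in r(e_i)$ for all $i$), all pairs $(\alpha,v)$ with $\alpha\in W$ and $v\in r(\alpha)$ a sink, and all pairs $(v,v)$ with $v$ a sink; the source of an element of $X$ is the source of its first edge, and $s(v,v)=v$. For $a\in W$ and $x\in X$ with $s(x)\in r(a)$ let $ax\in X$ be the concatenation (with $a(\alpha,v)=(a\alpha,v)$ and $a(v,v)=(a,v)$). Let $\mathbb F$ be the free group on $\mathcal G^1$, with neutral element $0$, and identify $W$ with a subset of $\mathbb F$. Define $X_0=X$; $X_a=\{az: z\in X,\ s(z)\in r(a)\}$ and $X_{a^{-1}}=\{x\in X:s(x)\in r(a)\}$ for $a\in W$; $X_{ab^{-1}}=\{az:z\in X,\ s(z)\in r(a)\cap r(b)\}$ for $a,b\in W$ that do not end with the same edge; and $X_c=\emptyset$ for all other $c\in\mathbb F$. Let $\theta_c:X_{c^{-1}}\to X_c$ be the bijections $\theta_0=\mathrm{id}$,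 $\theta_a(z)=az$, $\theta_{a^{-1}}(az)=z$, $\theta_{ab^{-1}}(bz)=az$, and the empty map in the remaining cases. Let $X_A=\{x\in X:s(x)\in A\}$ and $X_{bA}=\{x\in X_b : x=bz,\ s(z)\in A\}$ for $A\in\mathcal G^0$, $b\in W$, and write $1_A,1_{bA},1_c$ for the characteristic functions of $X_A,X_{bA},X_c$. Let $D$ be the (not necessarily unital) $R$-subalgebra of the algebra of all functions $X\to R$ generated by all $1_A$, all $1_{bA}$ and all $1_c$ with $c\in\mathbb F\setminus\{0\}$. For $t\in\mathbb F$ let $D_t$ be the ideal of $D$ consisting of the $R$-linear combinations of finite products of functions $1_tg$, with $g$ one of these generators of $D$, and let $\beta_t:D_{t^{-1}}\to D_t$, $\beta_t(f)=f\circ\theta_{t^{-1}}$ on $X_t$ (and $0$ elsewhere). This is a partial action of $\mathbb F$ on $D$. Its partial skew group ring $D\rtimes_\beta\mathbb F$ consists of the finite formal sums $\sum_t a_t\delta_t$ with $a_t\in D_t$, with multiplication $(a_t\delta_t)(b_s\delta_s)=\beta_t(\beta_{t^{-1}}(a_t)b_s)\delta_{ts}$. Then there exists an $R$-algebra isomorphism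 $\phi:L_R(\mathcal G)\to D\rtimes_\beta\mathbb F$ such that $\phi(p_A)=1_A\delta_0$, $\phi(s_e)=1_e\delta_e$ and $\phi(s_e^*)=1_{e^{-1}}\delta_{e^{-1}}$ for all $A\in\mathcal G^0$ and $e\in\mathcal G^1$. -/

import Mathlib

open scoped DirectSum

universe u v w

/-! ### Partial actions of groups on algebras and partial skew group rings -/

/-- A partial action of a group `G` on a (not necessarily unital) `R`-algebra `A`: ideals `D t` and
multiplicative `R`-linear isomorphisms `α t : D t⁻¹ → D t` such that `D 1 = A`, `α 1 = id`,
`α t (D t⁻¹ ∩ D s) = D t ∩ D (t * s)`, and `α t (α s x) = α (t * s) x` for all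
`x ∈ D s⁻¹ ∩ D (s⁻¹ * t⁻¹)`. -/
structure AlgPartialAction (R : Type u) (G : Type v) (A : Type w) [CommRing R] [Group G]
    [NonUnitalRing A] [Module R A] where
  D : G → Submodule R A
  mul_mem_left : ∀ (t : G) (a x : A), x ∈ D t → a * x ∈ D t
  mul_mem_right : ∀ (t : G) (a x : A), x ∈ D t → x * a ∈ D t
  α : ∀ t : G, D t⁻¹ ≃ₗ[R] D t
  α_mul : ∀ (t : G) (x y : D t⁻¹),
    (α t ⟨(x : A) * y, mul_mem_left t⁻¹ x y y.2⟩ : A) = (α t x : A) * (α t y : A)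
  D_one : D 1 = ⊤
  α_one : ∀ x : D (1 : G)⁻¹, (α 1 x : A) = x
  -- As `α t` is a bijection onto `D t`, this says `α t (D t⁻¹ ∩ D s) = D t ∩ D (t * s)`.
  α_mem_iff : ∀ (t s : G) (x : D t⁻¹), (x : A) ∈ D s ↔ (α t x : A) ∈ D (t * s)
  α_comp : ∀ (t s : G) (x : A) (h₁ : x ∈ D s⁻¹) (h₂ : x ∈ D (t * s)⁻¹),
    ∃ h₃ : (α s ⟨x, h₁⟩ : A) ∈ D t⁻¹,
      (α t ⟨(α s ⟨x, h₁⟩ : A), h₃⟩ : A) = α (t * s) ⟨x, h₂⟩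

namespace AlgPartialAction

variable {R : Type u} {G : Type v} {A : Type w} [CommRing R] [Group G] [NonUnitalRing A]
  [Module R A]

/-- The partial skew group ring: finite formal sums `∑ a_t δ_t` with `a_t ∈ D t`. -/
def SkewRing (P : AlgPartialAction R G A) : Type (max v w) := ⨁ t : G, P.D t

variable (P : AlgPartialAction R G A)

noncomputable instance : AddCommGroup P.SkewRing := inferInstanceAs (AddCommGroup (⨁ t : G, P.D t))

noncomputable instance : Module R P.SkewRing := inferInstanceAs (Module R (⨁ t : G, P.D t))

open scoped Classical in
/-- The monomial `a δ_t`, as a linear function of `a ∈ D t`. -/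
noncomputable def delta (t : G) : P.D t →ₗ[R] P.SkewRing :=
  DirectSum.lof R G (fun t : G => P.D t) t

open scoped Classical in
/-- The linear map out of the partial skew group ring with given values on monomials. -/
noncomputable def lift {M : Type*} [AddCommGroup M] [Module R M]
    (f : ∀ t : G, P.D t →ₗ[R] M) : P.SkewRing →ₗ[R] M :=
  DirectSum.toModule R G M f

theorem lift_delta {M : Type*} [AddCommGroup M] [Module R M]
    (f : ∀ t : G, P.D t →ₗ[R] M) (t : G) (a : P.D t) : P.lift f (P.delta t a) = f t a := by
  classical
  unfold lift delta
  exact DirectSum.toModule_lof (M := fun t : G => P.D t) R t a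

/-- The coefficient `α t (α t⁻¹ a * b) ∈ D (t * s)` of the product of `a δ_t` and `b δ_s`
(the map `α t⁻¹ : D t → D t⁻¹` is the inverse of `α t`). -/
noncomputable def coeffMul (t s : G) (a : P.D t) (b : P.D s) : P.D (t * s) :=
  ⟨P.α t ⟨((P.α t).symm a : A) * b, P.mul_mem_right _ _ _ ((P.α t).symm a).2⟩,
    (P.α_mem_iff t s _).1 (P.mul_mem_left _ _ _ b.2)⟩

/-- The `R`-bilinear multiplication with `(a δ_t) (b δ_s) = α t (α t⁻¹ a * b) δ_{t s}`. -/
noncomputable def mulHom [IsScalarTower R A A] [SMulCommClass R A A] :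
    P.SkewRing →ₗ[R] P.SkewRing →ₗ[R] P.SkewRing :=
  P.lift fun t => LinearMap.flip <| P.lift fun s =>
    LinearMap.flip <| (LinearMap.mk₂ R (P.coeffMul t s)
      (fun a a' b => by
        apply Subtype.ext
        change (P.α t _ : A) = (P.α t _ : A) + (P.α t _ : A)
        rw [← Submodule.coe_add, ← map_add]
        exact congrArg (fun z => (P.α t z : A)) (Subtype.ext (by simp [add_mul])))
      (fun c a b => by
        apply Subtype.ext
        change (P.α t _ : A) = c • (P.α t _ : A)
        rw [← Submodule.coe_smul, ← map_smul]
        exact congrArg (fun z => (P.α t z : A)) (Subtype.ext (by simp [smul_mul_assoc])))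
      (fun a b b' => by
        apply Subtype.ext
        change (P.α t _ : A) = (P.α t _ : A) + (P.α t _ : A)
        rw [← Submodule.coe_add, ← map_add]
        exact congrArg (fun z => (P.α t z : A)) (Subtype.ext (by simp [mul_add])))
      (fun c a b => by
        apply Subtype.ext
        change (P.α t _ : A) = c • (P.α t _ : A)
        rw [← Submodule.coe_smul, ← map_smul]
        exact congrArg (fun z => (P.α t z : A)) (Subtype.ext (by simp [mul_smul_comm])))).compr₂ (P.delta (t * s))

/-- The ring structure of the partial skew group ring. For a general partial action the product need
not be associative, so associativity is not part of this instance. -/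
noncomputable instance [IsScalarTower R A A] [SMulCommClass R A A] :
    NonUnitalNonAssocRing P.SkewRing :=
  { (inferInstance : AddCommGroup P.SkewRing) with
    mul := fun x y => P.mulHom x y
    left_distrib := fun x y z => map_add (P.mulHom x) y z
    right_distrib := fun x y z => by
      change P.mulHom (x + y) z = P.mulHom x z + P.mulHom y z
      rw [map_add, LinearMap.add_apply]
    zero_mul := fun x => by
      change P.mulHom 0 x = 0
      rw [map_zero, LinearMap.zero_apply]
    mul_zero := fun x => map_zero (P.mulHom x) }

theorem delta_mul_delta [IsScalarTower R A A] [SMulCommClass R A A] (t s : G) (a : P.D t)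
    (b : P.D s) : P.delta t a * P.delta s b = P.delta (t * s) (P.coeffMul t s a b) := by
  change P.mulHom (P.delta t a) (P.delta s b) = _
  unfold mulHom
  rw [lift_delta, LinearMap.flip_apply, lift_delta]
  rfl

end AlgPartialAction

/-! ### Ultragraphs -/

/-- An ultragraph with vertex set `V` and edge set `E`; countability of `V` and `E` is required
separately. -/
structure Ultragraph (V : Type u) (E : Type v) where
  s : E → V
  r : E → Set V
  r_nonempty : ∀ e, (r e).Nonempty

namespace Ultragraph

variable {V : Type u} {E : Type v}

/-- The smallest collection `𝒢⁰` of sets of vertices that contains all singletons `{v}` and all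
ranges `r e`, and is closed under finite unions (so it contains the empty set) and under
intersections of finite non-empty families. -/
inductive IsGenVertex (G : Ultragraph V E) : Set V → Prop
  | empty : IsGenVertex G ∅
  | singleton (v : V) : IsGenVertex G {v}
  | range (e : E) : IsGenVertex G (G.r e)
  | union {A B : Set V} : IsGenVertex G A → IsGenVertex G B → IsGenVertex G (A ∪ B)
  | inter {A B : Set V} : IsGenVertex G A → IsGenVertex G B → IsGenVertex G (A ∩ B)

/-- The generalized vertices, i.e. the elements of `𝒢⁰`. -/
abbrev GenVertex (G : Ultragraph V E) : Type u := {A : Set V // G.IsGenVertex A}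

/-! #### The Leavitt path algebra -/

/-- The generators `p_A`, `s_e`, `s_e^*`. -/
inductive Gen (G : Ultragraph V E) : Type (max u v)
  | p (A : G.GenVertex)
  | s (e : E)
  | sStar (e : E)

/-- The free non-unital associative `R`-algebra on the generators. -/
abbrev FreeAlg (G : Ultragraph V E) (R : Type w) [CommRing R] : Type (max u v w) :=
  MonoidAlgebra R (FreeSemigroup G.Gen)

/-- A generator, as an element of the free algebra. -/
noncomputable def gen (G : Ultragraph V E) (R : Type w) [CommRing R] (x : G.Gen) : G.FreeAlg R :=
  MonoidAlgebra.single (FreeSemigroup.of x) 1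

/-- The defining relations of the Leavitt path algebra. -/
inductive LeavittRel (G : Ultragraph V E) (R : Type w) [CommRing R] :
    G.FreeAlg R → G.FreeAlg R → Prop
  | p_empty : LeavittRel G R (G.gen R (.p ⟨∅, .empty⟩)) 0
  | p_inter (A B : G.GenVertex) : LeavittRel G R
      (G.gen R (.p A) * G.gen R (.p B)) (G.gen R (.p ⟨A.1 ∩ B.1, .inter A.2 B.2⟩))
  | p_union (A B : G.GenVertex) : LeavittRel G R
      (G.gen R (.p ⟨A.1 ∪ B.1, .union A.2 B.2⟩))
      (G.gen R (.p A) + G.gen R (.p B) - G.gen R (.p ⟨A.1 ∩ B.1, .inter A.2 B.2⟩))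
  | p_s (e : E) : LeavittRel G R
      (G.gen R (.p ⟨{G.s e}, .singleton _⟩) * G.gen R (.s e)) (G.gen R (.s e))
  | s_p (e : E) : LeavittRel G R
      (G.gen R (.s e) * G.gen R (.p ⟨G.r e, .range e⟩)) (G.gen R (.s e))
  | p_sStar (e : E) : LeavittRel G R
      (G.gen R (.p ⟨G.r e, .range e⟩) * G.gen R (.sStar e)) (G.gen R (.sStar e))
  | sStar_p (e : E) : LeavittRel G R
      (G.gen R (.sStar e) * G.gen R (.p ⟨{G.s e}, .singleton _⟩)) (G.gen R (.sStar e))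
  | sStar_s (e : E) : LeavittRel G R
      (G.gen R (.sStar e) * G.gen R (.s e)) (G.gen R (.p ⟨G.r e, .range e⟩))
  | sStar_s_ne (e f : E) (h : e ≠ f) : LeavittRel G R
      (G.gen R (.sStar e) * G.gen R (.s f)) 0
  | p_vertex (v : V) (hne : {e | G.s e = v}.Nonempty) (hfin : {e | G.s e = v}.Finite) :
      LeavittRel G R (G.gen R (.p ⟨{v}, .singleton v⟩))
        (∑ e ∈ hfin.toFinset, G.gen R (.s e) * G.gen R (.sStar e))

/-- The congruence generated by all scalar multiples of the defining relations, i.e. the smallest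
congruence of `R`-algebras that contains the relations. -/
noncomputable def leavittCon (G : Ultragraph V E) (R : Type w) [CommRing R] : RingCon (G.FreeAlg R) :=
  ringConGen fun x y => ∃ (c : R) (a b : G.FreeAlg R), G.LeavittRel R a b ∧ x = c • a ∧ y = c • b

theorem leavittCon_smul (G : Ultragraph V E) (R : Type w) [CommRing R] (c : R)
    {x y : G.FreeAlg R} (h : G.leavittCon R x y) : G.leavittCon R (c • x) (c • y) := by
  change RingConGen.Rel _ _ _ at h
  change RingConGen.Rel _ _ _
  induction h with
  | of x y h =>
    obtain ⟨d, a, b, h, rfl, rfl⟩ := h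
    exact .of _ _ ⟨c * d, a, b, h, by rw [mul_smul], by rw [mul_smul]⟩
  | refl x => exact .refl _
  | symm _ ih => exact .symm ih
  | trans _ _ ih₁ ih₂ => exact .trans ih₁ ih₂
  | add _ _ ih₁ ih₂ => rw [smul_add, smul_add]; exact .add ih₁ ih₂
  | mul _ h₂ ih₁ _ => rw [← smul_mul_assoc, ← smul_mul_assoc]; exact .mul ih₁ h₂

/-- The Leavitt path algebra `L_R(𝒢)`: the universal (not necessarily unital) `R`-algebra with the
given generators and relations. -/
def LeavittAlgebra (G : Ultragraph V E) (R : Type w) [CommRing R] : Type (max u v w) :=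
  (G.leavittCon R).Quotient

section LeavittAlgebra

variable (G : Ultragraph V E) (R : Type w) [CommRing R]

noncomputable instance : NonUnitalRing (G.LeavittAlgebra R) :=
  inferInstanceAs (NonUnitalRing (G.leavittCon R).Quotient)

/-- The quotient map from the free algebra. -/
noncomputable def LeavittAlgebra.mk (x : G.FreeAlg R) : G.LeavittAlgebra R := (x : (G.leavittCon R).Quotient)

noncomputable instance : SMul R (G.LeavittAlgebra R) where
  smul c := Quotient.map' (fun x => c • x) fun _ _ h => G.leavittCon_smul R c h

noncomputable instance : Module R (G.LeavittAlgebra R) :=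
  Function.Surjective.module R
    { toFun := LeavittAlgebra.mk G R, map_zero' := rfl, map_add' := fun _ _ => rfl }
    Quotient.mk''_surjective fun _ _ => rfl

instance : IsScalarTower R (G.LeavittAlgebra R) (G.LeavittAlgebra R) where
  smul_assoc c := Quotient.ind₂' fun x y =>
    congrArg (LeavittAlgebra.mk G R) (smul_mul_assoc c x y)

instance : SMulCommClass R (G.LeavittAlgebra R) (G.LeavittAlgebra R) where
  smul_comm c := Quotient.ind₂' fun x y =>
    congrArg (LeavittAlgebra.mk G R) (mul_smul_comm c x y).symm

namespace LeavittAlgebra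

/-- The generator `p_A`. -/
noncomputable def p (A : G.GenVertex) : G.LeavittAlgebra R := mk G R (G.gen R (.p A))

/-- The generator `s_e`. -/
noncomputable def s (e : E) : G.LeavittAlgebra R := mk G R (G.gen R (.s e))

/-- The generator `s_e^*`. -/
noncomputable def sStar (e : E) : G.LeavittAlgebra R := mk G R (G.gen R (.sStar e))

end LeavittAlgebra

end LeavittAlgebra

/-! #### Paths -/

/-- Finite sequences of edges followed by a vertex, and infinite sequences of edges. -/
inductive RawPath (V : Type u) (E : Type v) : Type (max u v)
  | fin (α : List E) (v : V)
  | inf (f : ℕ → E)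

namespace RawPath

/-- Put an edge in front of a path. -/
def cons (e : E) : RawPath V E → RawPath V E
  | fin α v => fin (e :: α) v
  | inf f => inf fun n => Nat.casesOn n e f

/-- The concatenation `a x`. -/
def append (a : List E) (x : RawPath V E) : RawPath V E := a.foldr cons x

end RawPath

section Paths

variable (G : Ultragraph V E)

/-- The range `r(a) = r(a_n)` of `a = a_1 … a_n`; all of `V` if `a` is empty. -/
def ran (a : List E) : Set V := {v | ∀ e ∈ a.getLast?, v ∈ G.r e}

/-- `s(a_{i+1}) ∈ r(a_i)` for all `i`. -/
def IsChain (a : List E) : Prop := a.IsChain fun e f => G.s f ∈ G.r e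

/-- The set `W` of finite paths of positive length. -/
def IsPath (a : List E) : Prop := a ≠ [] ∧ G.IsChain a

/-- A sink emits no edges. -/
def IsSink (v : V) : Prop := ∀ e, G.s e ≠ v

/-- The sequences in the set `X`: infinite paths, pairs `(α, v)` with `α` a path of positive length
and `v ∈ r(α)` a sink, and pairs `(v, v)` with `v` a sink; the latter are written `([], v)`. -/
def IsMem : RawPath V E → Prop
  | .fin α v => G.IsChain α ∧ G.IsSink v ∧ v ∈ G.ran α
  | .inf f => ∀ n, G.s (f (n + 1)) ∈ G.r (f n)

/-- The set `X`. -/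
def PathSpace : Type (max u v) := {x : RawPath V E // G.IsMem x}

/-- The source of an element of `X`. -/
def src : RawPath V E → V
  | .fin [] v => v
  | .fin (e :: _) _ => G.s e
  | .inf f => G.s (f 0)

/-- The set `X_A` of all `x ∈ X` with `s(x) ∈ A`. -/
def XA (A : Set V) : Set G.PathSpace := {x | G.src x.1 ∈ A}

/-- The set `X_{bA}` of all `x ∈ X` of the form `x = b z` with `z ∈ X` and `s(z) ∈ A`. -/
def XbA (b : List E) (A : Set V) : Set G.PathSpace :=
  {x | ∃ z : G.PathSpace, x.1 = z.1.append b ∧ G.src z.1 ∈ A}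

end Paths

/-- The element `a_1 … a_n` of the free group on the edges. -/
def word (a : List E) : FreeGroup E := (a.map FreeGroup.of).prod

section Action

variable (G : Ultragraph V E)

/-- `G.Link t x y` says that `θ_t` is defined at `x` and `θ_t(x) = y`, that is, `x = b z` and
`y = a z` with `t = a b⁻¹`, where `a` or `b` may be empty. That `x` and `y` lie in `X` forces `a`
and `b` to be paths (if non-empty) and `s(z) ∈ r(a) ∩ r(b)`. The expression `a b⁻¹` need not be
reduced here: if `a = a' c` and `b = b' c`, then `x = b' (c z)` and `y = a' (c z)`. -/
def Link (t : FreeGroup E) (x y : G.PathSpace) : Prop :=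
  ∃ (a b : List E) (z : RawPath V E),
    t = word a * (word b)⁻¹ ∧ x.1 = z.append b ∧ y.1 = z.append a

/-- The set `X_t`, the range of `θ_t`. For `t = a b⁻¹` reduced it consists of all `a z ∈ X` such that
`b z ∈ X`; see `Xt_one`, `Xt_word`, `Xt_word_inv`, `Xt_mixed` and `Xt_other` for the explicit
description. -/
def Xt (t : FreeGroup E) : Set G.PathSpace := {y | ∃ x, G.Link t x y}

end Action

/-! #### Facts about paths and words -/

namespace RawPath

theorem append_append (a b : List E) (x : RawPath V E) :
    (x.append b).append a = x.append (a ++ b) := by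
  simp [append, List.foldr_append]

theorem cons_inj {e f : E} {x y : RawPath V E} : x.cons e = y.cons f ↔ e = f ∧ x = y := by
  refine ⟨fun h => ?_, by rintro ⟨rfl, rfl⟩; rfl⟩
  cases x <;> cases y <;> simp only [cons] at h
  · injection h with h₁ h₂
    injection h₁ with h₁ h₃
    exact ⟨h₁, by rw [h₂, h₃]⟩
  · cases h
  · cases h
  · injection h with h
    exact ⟨congrFun h 0, by congr 1; funext n; exact congrFun h (n + 1)⟩

theorem append_inj {a : List E} {x y : RawPath V E} (h : x.append a = y.append a) : x = y := by
  induction a with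
  | nil => exact h
  | cons e a ih => exact ih (cons_inj.1 h).2

theorem append_comparable {a c : List E} {x y : RawPath V E} (h : x.append a = y.append c) :
    (∃ k, c = a ++ k ∧ x = y.append k) ∨ ∃ k, a = c ++ k ∧ y = x.append k := by
  induction a generalizing c with
  | nil => exact .inl ⟨c, rfl, h⟩
  | cons e a ih =>
    cases c with
    | nil => exact .inr ⟨e :: a, rfl, h.symm⟩
    | cons f c =>
      obtain ⟨rfl, h'⟩ := cons_inj.1 h
      rcases ih h' with ⟨k, rfl, hk⟩ | ⟨k, rfl, hk⟩
      · exact .inl ⟨k, rfl, hk⟩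
      · exact .inr ⟨k, rfl, hk⟩

end RawPath

theorem src_cons (G : Ultragraph V E) (e : E) (x : RawPath V E) : G.src (x.cons e) = G.s e := by
  cases x <;> rfl

theorem isMem_cons (G : Ultragraph V E) {e : E} {x : RawPath V E} :
    G.IsMem (x.cons e) ↔ G.src x ∈ G.r e ∧ G.IsMem x := by
  cases x with
  | fin α v =>
    cases α with
    | nil => simp [RawPath.cons, IsMem, IsChain, ran, src, and_comm]
    | cons f α => simp [RawPath.cons, IsMem, IsChain, ran, src, and_assoc]
  | inf f =>
    refine ⟨fun h => ⟨h 0, fun n => h (n + 1)⟩, fun h n => ?_⟩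
    cases n with
    | zero => exact h.1
    | succ n => exact h.2 n

theorem isMem_append (G : Ultragraph V E) {a : List E} {x : RawPath V E} :
    G.IsMem (x.append a) ↔ G.IsChain a ∧ G.src x ∈ G.ran a ∧ G.IsMem x := by
  induction a with
  | nil => simp [RawPath.append, IsChain, ran]
  | cons e a ih =>
    change G.IsMem ((x.append a).cons e) ↔ _
    rw [isMem_cons, ih]
    cases a with
    | nil => simp [RawPath.append, IsChain, ran]
    | cons f a =>
      change G.src ((x.append a).cons f) ∈ _ ∧ _ ↔ _
      rw [src_cons]
      simp [IsChain, ran, and_assoc]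

theorem isMem_of_append (G : Ultragraph V E) {a : List E} {x : RawPath V E}
    (h : G.IsMem (x.append a)) : G.IsMem x := (G.isMem_append.1 h).2.2

theorem word_append (a b : List E) : word (a ++ b) = word a * word b := by simp [word]

theorem word_nil : word ([] : List E) = 1 := rfl

theorem word_cons (e : E) (a : List E) : word (e :: a) = FreeGroup.of e * word a := by simp [word]

theorem word_singleton (e : E) : word [e] = FreeGroup.of e := by simp [word]

/-- `a b⁻¹` is reduced as it stands: `a` and `b` do not end with the same edge. -/
def Red (a b : List E) : Prop := ∀ e ∈ a.getLast?, e ∉ b.getLast?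

theorem word_eq_mk (a : List E) : word a = FreeGroup.mk (a.map fun e => (e, true)) := by
  induction a with
  | nil => rfl
  | cons e a ih => rw [word_cons, ih]; rfl

theorem inv_word_eq_mk (b : List E) :
    (word b)⁻¹ = FreeGroup.mk (b.map fun e => (e, false)).reverse := by
  rw [word_eq_mk, FreeGroup.inv_mk, FreeGroup.invRev]
  simp [Function.comp_def]

theorem word_mul_inv_eq_mk (a b : List E) : word a * (word b)⁻¹ =
    FreeGroup.mk ((a.map fun e => (e, true)) ++ (b.map fun e => (e, false)).reverse) := by
  rw [inv_word_eq_mk, word_eq_mk, FreeGroup.mul_mk]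

theorem Red.isReduced {a b : List E} (h : Red a b) : FreeGroup.IsReduced
    ((a.map fun e => (e, true)) ++ (b.map fun e => (e, false)).reverse) := by
  have key : ∀ (c : Bool) (l : List (E × Bool)), (∀ x ∈ l, x.2 = c) → FreeGroup.IsReduced l := by
    intro c l hl
    induction l with
    | nil => exact .nil
    | cons x l ih =>
      cases l with
      | nil => exact .singleton
      | cons y l =>
        rw [FreeGroup.isReduced_cons_cons]
        exact ⟨fun _ => by rw [hl x (by simp), hl y (by simp)],
          ih fun z hz => hl z (List.mem_cons_of_mem _ hz)⟩
  unfold FreeGroup.IsReduced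
  rw [List.isChain_append]
  refine ⟨key true _ (by simp), key false _ (by simp), ?_⟩
  intro x hx y hy hxy
  rw [List.getLast?_map] at hx
  rw [List.head?_reverse, List.getLast?_map] at hy
  obtain ⟨e, he, rfl⟩ := Option.mem_map.1 hx
  obtain ⟨f, hf, rfl⟩ := Option.mem_map.1 hy
  obtain rfl : e = f := hxy
  exact absurd hf (h e he)

theorem Red.unique {a b a' b' : List E} (h : Red a b) (h' : Red a' b')
    (heq : word a * (word b)⁻¹ = word a' * (word b')⁻¹) : a = a' ∧ b = b' := by
  classical
  rw [word_mul_inv_eq_mk, word_mul_inv_eq_mk] at heq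
  have := congrArg FreeGroup.toWord heq
  rw [FreeGroup.toWord_mk, FreeGroup.toWord_mk, h.isReduced.reduce_eq, h'.isReduced.reduce_eq]
    at this
  have inj : ∀ c : Bool, Function.Injective fun e : E => (e, c) := fun c e f h => congrArg Prod.fst h
  constructor
  · have := congrArg (List.filter fun x => x.2) this
    simp only [List.filter_append, List.filter_reverse, List.filter_map] at this
    exact List.map_injective_iff.2 (inj true) (by simpa [Function.comp_def] using this)
  · have := congrArg (List.filter fun x => !x.2) this
    simp only [List.filter_append, List.filter_reverse, List.filter_map] at this
    exact List.map_injective_iff.2 (inj false) (by simpa [Function.comp_def] using this)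

theorem exists_red (a b : List E) : ∃ a' b' c, a = a' ++ c ∧ b = b' ++ c ∧ Red a' b' := by
  induction a using List.reverseRecOn generalizing b with
  | nil => exact ⟨[], b, [], rfl, by simp, by simp [Red]⟩
  | append_singleton a e ih =>
    by_cases h : Red (a ++ [e]) b
    · exact ⟨a ++ [e], b, [], by simp, by simp, h⟩
    · simp only [Red, List.getLast?_append, List.getLast?_singleton, Option.some_or, Option.mem_def,
        Option.some.injEq, forall_eq', not_not] at h
      obtain ⟨b', rfl⟩ := List.getLast?_eq_some_iff.1 h
      obtain ⟨a', b', c, rfl, rfl, hr⟩ := ih b'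
      exact ⟨a', b', c ++ [e], by simp, by simp, hr⟩

theorem Red.exists_append {a b a' b' : List E} (h : Red a b)
    (heq : word a * (word b)⁻¹ = word a' * (word b')⁻¹) : ∃ c, a' = a ++ c ∧ b' = b ++ c := by
  obtain ⟨a₁, b₁, c, rfl, rfl, hr⟩ := exists_red a' b'
  rw [word_append, word_append] at heq
  obtain ⟨rfl, rfl⟩ := h.unique hr (heq.trans (by group))
  exact ⟨c, rfl, rfl⟩

theorem word_injective : Function.Injective (word : List E → FreeGroup E) := by
  intro a b h
  exact (Red.unique (a := a) (b := []) (a' := b) (b' := []) (by simp [Red]) (by simp [Red])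
    (by rw [h])).1

/-! #### The partial action on the path space -/

section Action

variable {G : Ultragraph V E}

theorem link_inv {t : FreeGroup E} {x y : G.PathSpace} : G.Link t⁻¹ y x ↔ G.Link t x y := by
  constructor
  · rintro ⟨a, b, z, h, hy, hx⟩
    exact ⟨b, a, z, by rw [← inv_inv t, h]; group, hx, hy⟩
  · rintro ⟨a, b, z, h, hx, hy⟩
    exact ⟨b, a, z, by rw [h]; group, hy, hx⟩

theorem Link.comp {t s : FreeGroup E} {x y w : G.PathSpace} (h₁ : G.Link t x y)
    (h₂ : G.Link s y w) : G.Link (s * t) x w := by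
  obtain ⟨a, b, z, rfl, hx, hy⟩ := h₁
  obtain ⟨d, c, u, rfl, hy', hw⟩ := h₂
  rcases RawPath.append_comparable (hy.symm.trans hy') with ⟨k, rfl, rfl⟩ | ⟨k, rfl, rfl⟩
  · refine ⟨d, b ++ k, u, by simp only [word_append]; group, ?_, hw⟩
    rw [hx, RawPath.append_append]
  · refine ⟨d ++ k, b, z, by simp only [word_append]; group, hx, ?_⟩
    rw [hw, RawPath.append_append]

theorem link_one {x y : G.PathSpace} : G.Link 1 x y ↔ x = y := by
  constructor
  · rintro ⟨a, b, z, h, hx, hy⟩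
    obtain rfl : a = b := word_injective (mul_inv_eq_one.1 h.symm)
    exact Subtype.ext (hx.trans hy.symm)
  · rintro rfl
    exact ⟨[], [], x.1, by simp [word_nil], rfl, rfl⟩

theorem Link.right_unique {t : FreeGroup E} {x y y' : G.PathSpace} (h : G.Link t x y)
    (h' : G.Link t x y') : y = y' := by
  have := (link_inv.2 h).comp h'
  rwa [mul_inv_cancel, link_one] at this

theorem Link.left_unique {t : FreeGroup E} {x x' y : G.PathSpace} (h : G.Link t x y)
    (h' : G.Link t x' y) : x = x' :=
  (link_inv.2 h).right_unique (link_inv.2 h')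

theorem Link.mem {t : FreeGroup E} {x y : G.PathSpace} (h : G.Link t x y) : y ∈ G.Xt t := ⟨x, h⟩

theorem Link.mem_inv {t : FreeGroup E} {x y : G.PathSpace} (h : G.Link t x y) : x ∈ G.Xt t⁻¹ :=
  ⟨y, link_inv.2 h⟩

theorem mem_Xt_mul_iff {t s : FreeGroup E} {x y : G.PathSpace} (h : G.Link t x y) :
    y ∈ G.Xt (t * s) ↔ x ∈ G.Xt s := by
  constructor
  · rintro ⟨w, hw⟩
    have := hw.comp (link_inv.2 h)
    rw [inv_mul_cancel_left] at this
    exact this.mem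
  · rintro ⟨w, hw⟩
    exact (hw.comp h).mem

variable (G)

theorem link_red {a b : List E} (h : Red a b) {x y : G.PathSpace} :
    G.Link (word a * (word b)⁻¹) x y ↔ ∃ z : RawPath V E, x.1 = z.append b ∧ y.1 = z.append a := by
  constructor
  · rintro ⟨a', b', z, heq, hx, hy⟩
    obtain ⟨c, rfl, rfl⟩ := h.exists_append heq
    exact ⟨z.append c, by rw [hx, RawPath.append_append], by rw [hy, RawPath.append_append]⟩
  · rintro ⟨z, hx, hy⟩
    exact ⟨a, b, z, rfl, hx, hy⟩

theorem Xt_one : G.Xt 1 = Set.univ :=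
  Set.eq_univ_of_forall fun x => (link_one.2 (rfl : x = x)).mem

/-- For `a ∈ W`, the set `X_a` consists of the elements of `X` that begin with `a`. -/
theorem Xt_word (a : List E) : G.Xt (word a) = {x | ∃ z : RawPath V E, x.1 = z.append a} := by
  have hr : Red a ([] : List E) := by simp [Red]
  ext x
  constructor
  · rintro ⟨y, h⟩
    rw [show word a = word a * (word [])⁻¹ by simp [word_nil]] at h
    obtain ⟨z, -, hz⟩ := (G.link_red hr).1 h
    exact ⟨z, hz⟩
  · rintro ⟨z, hz⟩
    exact ⟨⟨z, G.isMem_of_append (a := a) (hz ▸ x.2)⟩, a, [], z, by simp [word_nil], rfl, hz⟩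

/-- For `b ∈ W`, the set `X_{b⁻¹}` consists of the `x ∈ X` with `s(x) ∈ r(b)`. -/
theorem Xt_word_inv {b : List E} (hb : G.IsPath b) : G.Xt (word b)⁻¹ = G.XA (G.ran b) := by
  have hr : Red ([] : List E) b := by simp [Red]
  ext x
  constructor
  · rintro ⟨y, h⟩
    rw [show (word b)⁻¹ = word [] * (word b)⁻¹ by simp [word_nil]] at h
    obtain ⟨z, hy, hz⟩ := (G.link_red hr).1 h
    have := (G.isMem_append.1 (hy ▸ y.2)).2.1
    rwa [← show x.1 = z from hz] at this
  · intro h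
    exact ⟨⟨x.1.append b, G.isMem_append.2 ⟨hb.2, h, x.2⟩⟩, [], b, x.1, by simp [word_nil], rfl, rfl⟩

/-- For `a, b ∈ W` not ending with the same edge, `X_{a b⁻¹}` consists of the `a z ∈ X` with
`s(z) ∈ r(a) ∩ r(b)`. -/
theorem Xt_mixed {a b : List E} (hb : G.IsPath b) (hr : Red a b) :
    G.Xt (word a * (word b)⁻¹) = G.XbA a (G.ran a ∩ G.ran b) := by
  ext x
  constructor
  · rintro ⟨y, h⟩
    obtain ⟨z, hy, hz⟩ := (G.link_red hr).1 h
    have h₁ := G.isMem_append.1 (hy ▸ y.2)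
    have h₂ := G.isMem_append.1 (hz ▸ x.2)
    exact ⟨⟨z, h₁.2.2⟩, hz, h₂.2.1, h₁.2.1⟩
  · rintro ⟨z, hz, -, h⟩
    exact ⟨⟨z.1.append b, G.isMem_append.2 ⟨hb.2, h, z.2⟩⟩, a, b, z.1, rfl, rfl, hz⟩

/-- If `t` is not of the form `a b⁻¹` with `a, b ∈ W ∪ {0}`, then `X_t` is empty. -/
theorem Xt_other {t : FreeGroup E}
    (ht : ∀ a b : List E, G.IsChain a → G.IsChain b → t ≠ word a * (word b)⁻¹) :
    G.Xt t = ∅ := by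
  refine Set.eq_empty_of_forall_notMem ?_
  rintro y ⟨x, a, b, z, rfl, hx, hy⟩
  exact ht a b (G.isMem_append.1 (hy ▸ y.2)).1 (G.isMem_append.1 (hx ▸ x.2)).1 rfl

/-- The bijection `θ_t : X_{t⁻¹} → X_t`. -/
noncomputable def theta (t : FreeGroup E) : G.Xt t⁻¹ ≃ G.Xt t where
  toFun x := ⟨x.2.choose, (link_inv.1 x.2.choose_spec).mem⟩
  invFun y := ⟨y.2.choose, y.2.choose_spec.mem_inv⟩
  left_inv x := Subtype.ext <| Link.left_unique
    (Exists.choose_spec (link_inv.1 x.2.choose_spec).mem) (link_inv.1 x.2.choose_spec)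
  right_inv y := Subtype.ext <| Link.right_unique
    (link_inv.1 (Exists.choose_spec y.2.choose_spec.mem_inv)) y.2.choose_spec

theorem link_theta (t : FreeGroup E) (x : G.Xt t⁻¹) : G.Link t x (G.theta t x) :=
  link_inv.1 x.2.choose_spec

theorem theta_symm_eq {t : FreeGroup E} {x y : G.PathSpace} (h : G.Link t x y) :
    ((G.theta t).symm ⟨y, h.mem⟩ : G.PathSpace) = x := by
  have := G.link_theta t ((G.theta t).symm ⟨y, h.mem⟩)
  rw [Equiv.apply_symm_apply] at this
  exact this.left_unique h

end Action

/-! #### The algebra `D` and the partial action on it -/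

section Algebra

variable (G : Ultragraph V E) (R : Type w) [CommRing R]

/-- The characteristic function of a subset of `X`. -/
noncomputable def chi (S : Set G.PathSpace) : G.PathSpace → R := S.indicator fun _ => 1

/-- The generators `1_A`, `1_{bA}` and `1_c` (`c` not the neutral element) of `D`. -/
def dGens : Set (G.PathSpace → R) :=
  {f | ∃ A, G.IsGenVertex A ∧ f = G.chi R (G.XA A)} ∪
  {f | ∃ b A, G.IsPath b ∧ G.IsGenVertex A ∧ f = G.chi R (G.XbA b A)} ∪
  {f | ∃ c, c ≠ 1 ∧ f = G.chi R (G.Xt c)}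

/-- The algebra `D`: the (not necessarily unital) subalgebra of the algebra of all functions
`X → R` consisting of the linear combinations of finite products of generators. -/
def DAlg : NonUnitalSubalgebra R (G.PathSpace → R) := NonUnitalAlgebra.adjoin R (G.dGens R)

/-- The ideal `D_t` of `D`, consisting of the linear combinations of finite products of functions
`1_t g`, where `g` is a generator of `D`. -/
def Dt (t : FreeGroup E) : Submodule R (G.DAlg R) :=
  (NonUnitalAlgebra.adjoin R
    {f | ∃ g ∈ G.dGens R, f = G.chi R (G.Xt t) * g}).toSubmodule.comap
      (G.DAlg R).toSubmodule.subtype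

open scoped Classical in
/-- The map `β_t(f) = f ∘ θ_{t⁻¹}` (extended by `0` outside of `X_t`). -/
noncomputable def betaFun (t : FreeGroup E) : (G.PathSpace → R) →ₗ[R] (G.PathSpace → R) where
  toFun f y := if h : y ∈ G.Xt t then f ((G.theta t).symm ⟨y, h⟩) else 0
  map_add' f g := by
    funext y
    by_cases h : y ∈ G.Xt t <;> simp [h]
  map_smul' c f := by
    funext y
    by_cases h : y ∈ G.Xt t <;> simp [h]

variable {G R}

theorem chi_of_mem {S : Set G.PathSpace} {x : G.PathSpace} (h : x ∈ S) : G.chi R S x = 1 :=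
  Set.indicator_of_mem h _

theorem chi_of_notMem {S : Set G.PathSpace} {x : G.PathSpace} (h : x ∉ S) : G.chi R S x = 0 :=
  Set.indicator_of_notMem h _

theorem chi_mul_chi (S T : Set G.PathSpace) : G.chi R S * G.chi R T = G.chi R (S ∩ T) := by
  classical
  funext x
  by_cases h₁ : x ∈ S <;> by_cases h₂ : x ∈ T <;> simp [chi, h₁, h₂]

theorem chi_univ : G.chi R Set.univ = 1 := by
  funext x
  simp [chi]

theorem chi_empty : G.chi R ∅ = 0 := by
  funext x
  simp [chi]

theorem chi_XA_mem {A : Set V} (hA : G.IsGenVertex A) : G.chi R (G.XA A) ∈ G.DAlg R :=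
  NonUnitalAlgebra.subset_adjoin R (.inl (.inl ⟨A, hA, rfl⟩))

theorem chi_XbA_mem {b : List E} {A : Set V} (hb : G.IsPath b) (hA : G.IsGenVertex A) :
    G.chi R (G.XbA b A) ∈ G.DAlg R :=
  NonUnitalAlgebra.subset_adjoin R (.inl (.inr ⟨b, A, hb, hA, rfl⟩))

theorem chi_Xt_mem {t : FreeGroup E} (ht : t ≠ 1) : G.chi R (G.Xt t) ∈ G.DAlg R :=
  NonUnitalAlgebra.subset_adjoin R (.inr ⟨t, ht, rfl⟩)

theorem chi_Xt_mul_mem (t : FreeGroup E) {f : G.PathSpace → R} (hf : f ∈ G.DAlg R) :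
    G.chi R (G.Xt t) * f ∈ G.DAlg R := by
  by_cases ht : t = 1
  · subst ht
    rwa [Xt_one, chi_univ, one_mul]
  · exact mul_mem (chi_Xt_mem ht) hf

theorem chi_mul_eq_self {S : Set G.PathSpace} {f : G.PathSpace → R} (h : ∀ x ∉ S, f x = 0) :
    G.chi R S * f = f := by
  funext x
  by_cases hx : x ∈ S
  · simp [chi_of_mem hx]
  · simp [h x hx]

/-- `D_t` consists of the functions in `D` that vanish outside of `X_t`. -/
theorem mem_Dt_iff {t : FreeGroup E} {f : G.DAlg R} :
    f ∈ G.Dt R t ↔ ∀ x ∉ G.Xt t, f.1 x = 0 := by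
  constructor
  · intro h x hx
    change f.1 ∈ NonUnitalAlgebra.adjoin R _ at h
    generalize f.1 = f at h ⊢
    induction h using NonUnitalAlgebra.adjoin_induction with
    | mem g hg =>
      obtain ⟨g, -, rfl⟩ := hg
      simp [chi_of_notMem hx]
    | add f g _ _ hf hg => simp [hf, hg]
    | zero => rfl
    | mul f g _ _ hf hg => simp [hf]
    | smul c f _ hf => simp [hf]
  · intro h
    have key : ∀ g ∈ G.DAlg R, G.chi R (G.Xt t) * g ∈ NonUnitalAlgebra.adjoin R
        {f | ∃ g ∈ G.dGens R, f = G.chi R (G.Xt t) * g} := by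
      intro g hg
      induction hg using NonUnitalAlgebra.adjoin_induction with
      | mem g hg => exact NonUnitalAlgebra.subset_adjoin R ⟨g, hg, rfl⟩
      | add f g _ _ hf hg => rw [mul_add]; exact add_mem hf hg
      | zero => rw [mul_zero]; exact zero_mem _
      | mul f g _ _ hf hg =>
        have : G.chi R (G.Xt t) * (f * g) =
            (G.chi R (G.Xt t) * f) * (G.chi R (G.Xt t) * g) := by
          rw [mul_mul_mul_comm, chi_mul_chi, Set.inter_self]
        rw [this]
        exact mul_mem hf hg
      | smul c f _ hf => rw [mul_smul_comm]; exact SMulMemClass.smul_mem c hf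
    have := key f.1 f.2
    rwa [chi_mul_eq_self h] at this

theorem betaFun_apply {t : FreeGroup E} {x y : G.PathSpace} (h : G.Link t x y)
    (f : G.PathSpace → R) : G.betaFun R t f y = f x := by
  simp [betaFun, h.mem, theta_symm_eq G h]

theorem betaFun_of_notMem {t : FreeGroup E} {y : G.PathSpace} (h : y ∉ G.Xt t)
    (f : G.PathSpace → R) : G.betaFun R t f y = 0 := by
  simp [betaFun, h]

theorem betaFun_mul (t : FreeGroup E) (f g : G.PathSpace → R) :
    G.betaFun R t (f * g) = G.betaFun R t f * G.betaFun R t g := by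
  funext y
  by_cases h : y ∈ G.Xt t
  · obtain ⟨x, hx⟩ := h
    simp [betaFun_apply hx]
  · simp [betaFun_of_notMem h]

theorem betaFun_chi (t : FreeGroup E) (S : Set G.PathSpace) :
    G.betaFun R t (G.chi R S) = G.chi R {y | ∃ x ∈ S, G.Link t x y} := by
  funext y
  by_cases h : y ∈ G.Xt t
  · obtain ⟨x, hx⟩ := h
    rw [betaFun_apply hx]
    by_cases hS : x ∈ S
    · rw [chi_of_mem hS]
      exact (chi_of_mem (S := {y | ∃ x ∈ S, G.Link t x y}) ⟨x, hS, hx⟩).symm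
    · rw [chi_of_notMem hS, chi_of_notMem]
      rintro ⟨x', hx', hl⟩
      exact hS (hl.left_unique hx ▸ hx')
  · rw [betaFun_of_notMem h, chi_of_notMem]
    rintro ⟨x, -, hl⟩
    exact h hl.mem

theorem betaFun_chi_Xt (t c : FreeGroup E) :
    G.betaFun R t (G.chi R (G.Xt c)) = G.chi R (G.Xt t) * G.chi R (G.Xt (t * c)) := by
  rw [betaFun_chi, chi_mul_chi]
  congr 1
  ext y
  constructor
  · rintro ⟨x, hx, hl⟩
    exact ⟨hl.mem, (mem_Xt_mul_iff hl).2 hx⟩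
  · rintro ⟨⟨x, hl⟩, h⟩
    exact ⟨x, (mem_Xt_mul_iff hl).1 h, hl⟩

theorem betaFun_comp_inv {t : FreeGroup E} {f : G.PathSpace → R} (h : ∀ x ∉ G.Xt t⁻¹, f x = 0) :
    G.betaFun R t⁻¹ (G.betaFun R t f) = f := by
  funext x
  by_cases hx : x ∈ G.Xt t⁻¹
  · obtain ⟨y, hy⟩ := hx
    rw [betaFun_apply hy, betaFun_apply (link_inv.1 hy)]
  · rw [betaFun_of_notMem hx, h x hx]

theorem chi_Xt_mul_self_mem {t c : FreeGroup E} (ht : t ≠ 1) :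
    G.chi R (G.Xt t) * G.chi R (G.Xt c) ∈ G.DAlg R := by
  rw [mul_comm]
  exact chi_Xt_mul_mem c (chi_Xt_mem ht)

theorem link_of {e : E} {x y : G.PathSpace} :
    G.Link (FreeGroup.of e) x y ↔ y.1 = x.1.cons e := by
  have hr : Red [e] ([] : List E) := by simp [Red]
  have := G.link_red hr (x := x) (y := y)
  rw [word_singleton, word_nil, inv_one, mul_one] at this
  rw [this]
  constructor
  · rintro ⟨z, hx, hy⟩
    rw [hy, hx]
    rfl
  · intro h
    exact ⟨x.1, rfl, h⟩

theorem betaFun_mem_of_gens {t : FreeGroup E}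
    (h : ∀ g ∈ G.dGens R, G.betaFun R t g ∈ G.DAlg R) {f : G.PathSpace → R} (hf : f ∈ G.DAlg R) :
    G.betaFun R t f ∈ G.DAlg R := by
  induction hf using NonUnitalAlgebra.adjoin_induction with
  | mem g hg => exact h g hg
  | add f g _ _ hf hg => rw [map_add]; exact add_mem hf hg
  | zero => rw [map_zero]; exact zero_mem _
  | mul f g _ _ hf hg => rw [betaFun_mul]; exact mul_mem hf hg
  | smul c f _ hf => rw [map_smul]; exact SMulMemClass.smul_mem c hf

theorem betaFun_of_mem (e : E) {f : G.PathSpace → R} (hf : f ∈ G.DAlg R) :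
    G.betaFun R (FreeGroup.of e) f ∈ G.DAlg R := by
  refine betaFun_mem_of_gens ?_ hf
  rintro _ ((⟨A, hA, rfl⟩ | ⟨b, A, hb, hA, rfl⟩) | ⟨c, hc, rfl⟩)
  · have he : G.IsPath [e] := ⟨by simp, by simp [IsChain]⟩
    convert chi_XbA_mem (R := R) he hA using 1
    rw [betaFun_chi]
    congr 1
    ext y
    constructor
    · rintro ⟨x, hx, hl⟩
      exact ⟨x, link_of.1 hl, hx⟩
    · rintro ⟨x, hl, hx⟩
      exact ⟨x, hx, link_of.2 hl⟩
  · rw [betaFun_chi]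
    by_cases h : G.IsPath (e :: b)
    · convert chi_XbA_mem (R := R) h hA using 2
      ext y
      constructor
      · rintro ⟨x, ⟨z, hz, hzA⟩, hl⟩
        exact ⟨z, by rw [link_of.1 hl, hz]; rfl, hzA⟩
      · rintro ⟨z, hz, hzA⟩
        have hy := y.2
        rw [hz] at hy
        refine ⟨⟨z.1.append b, (G.isMem_cons.1 hy).2⟩, ⟨z, rfl, hzA⟩, link_of.2 hz⟩
    · convert zero_mem (G.DAlg R) using 1
      rw [← chi_empty]
      congr 1
      refine Set.eq_empty_of_forall_notMem ?_
      rintro y ⟨x, ⟨z, hz, -⟩, hl⟩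
      refine h ⟨by simp, ?_⟩
      have hy := y.2
      rw [link_of.1 hl, hz] at hy
      exact (G.isMem_append (a := e :: b).1 hy).1
  · rw [betaFun_chi_Xt]
    exact chi_Xt_mul_self_mem (FreeGroup.of_ne_one e)

theorem betaFun_of_inv_mem (e : E) {f : G.PathSpace → R} (hf : f ∈ G.DAlg R) :
    G.betaFun R (FreeGroup.of e)⁻¹ f ∈ G.DAlg R := by
  have hne : (FreeGroup.of e)⁻¹ ≠ 1 := inv_ne_one.2 (FreeGroup.of_ne_one e)
  refine betaFun_mem_of_gens ?_ hf
  rintro _ ((⟨A, hA, rfl⟩ | ⟨b, A, hb, hA, rfl⟩) | ⟨c, hc, rfl⟩)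
  · rw [betaFun_chi]
    by_cases h : G.s e ∈ A
    · convert chi_Xt_mem (R := R) (G := G) hne using 2
      ext x
      constructor
      · rintro ⟨y, -, hl⟩
        exact hl.mem
      · rintro ⟨y, hl⟩
        refine ⟨y, ?_, hl⟩
        change G.src y.1 ∈ A
        rwa [link_of.1 (link_inv.1 hl), src_cons]
    · convert zero_mem (G.DAlg R) using 1
      rw [← chi_empty]
      congr 1
      refine Set.eq_empty_of_forall_notMem ?_
      rintro x ⟨y, hy, hl⟩
      change G.src y.1 ∈ A at hy
      rw [link_of.1 (link_inv.1 hl), src_cons] at hy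
      exact h hy
  · rw [betaFun_chi]
    obtain _ | ⟨f, b⟩ := b
    · exact absurd rfl hb.1
    by_cases hef : e = f
    · subst hef
      have hset : {x | ∃ y ∈ G.XbA (e :: b) A, G.Link (FreeGroup.of e)⁻¹ y x} =
          G.Xt (FreeGroup.of e)⁻¹ ∩ G.XbA b A := by
        ext x
        constructor
        · rintro ⟨y, ⟨z, hz, hzA⟩, hl⟩
          refine ⟨hl.mem, z, ?_, hzA⟩
          exact (RawPath.cons_inj.1 ((link_of.1 (link_inv.1 hl)).symm.trans hz)).2
        · rintro ⟨⟨y, hl⟩, z, hz, hzA⟩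
          exact ⟨y, ⟨z, by rw [link_of.1 (link_inv.1 hl), hz]; rfl, hzA⟩, hl⟩
      rw [hset, ← chi_mul_chi]
      apply chi_Xt_mul_mem
      by_cases hb' : b = []
      · subst hb'
        convert chi_XA_mem (R := R) hA using 2
        ext x
        constructor
        · rintro ⟨z, hz, hzA⟩
          obtain rfl : x = z := Subtype.ext hz
          exact hzA
        · intro h
          exact ⟨x, rfl, h⟩
      · exact chi_XbA_mem ⟨hb', List.IsChain.of_cons hb.2⟩ hA
    · convert zero_mem (G.DAlg R) using 1
      rw [← chi_empty]
      congr 1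
      refine Set.eq_empty_of_forall_notMem ?_
      rintro x ⟨y, ⟨z, hz, -⟩, hl⟩
      exact hef (RawPath.cons_inj.1 ((link_of.1 (link_inv.1 hl)).symm.trans hz)).1
  · rw [betaFun_chi_Xt]
    exact chi_Xt_mul_self_mem hne

theorem betaFun_comp {t s : FreeGroup E} (f : G.PathSpace → R)
    (h : ∀ x y, G.Link (t * s) x y → y ∈ G.Xt t) :
    G.betaFun R (t * s) f = G.betaFun R t (G.betaFun R s f) := by
  funext y
  by_cases hy : y ∈ G.Xt t
  · obtain ⟨w, hw⟩ := hy
    rw [betaFun_apply hw]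
    by_cases hw' : w ∈ G.Xt s
    · obtain ⟨x, hx⟩ := hw'
      rw [betaFun_apply hx, betaFun_apply (hx.comp hw)]
    · rw [betaFun_of_notMem hw', betaFun_of_notMem]
      rwa [mem_Xt_mul_iff hw]
  · rw [betaFun_of_notMem hy, betaFun_of_notMem]
    rintro ⟨x, hx⟩
    exact hy (h x y hx)

theorem betaFun_red_mem {a b : List E} (hr : Red a b) {f : G.PathSpace → R}
    (hf : f ∈ G.DAlg R) : G.betaFun R (word a * (word b)⁻¹) f ∈ G.DAlg R := by
  induction a with
  | nil =>
    rw [word_nil, one_mul]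
    clear hr
    induction b generalizing f with
    | nil =>
      convert hf using 1
      funext x
      exact betaFun_apply (by rw [word_nil, inv_one, link_one]) f
    | cons e b ih =>
      rw [word_cons, mul_inv_rev, betaFun_comp]
      · exact ih (betaFun_of_inv_mem e hf)
      · intro x y hl
        rw [← mul_inv_rev, ← word_cons, ← one_mul (word (e :: b))⁻¹, ← word_nil] at hl
        obtain ⟨z, hx, hy⟩ := (G.link_red (by simp [Red])).1 hl
        have hx' := x.2
        rw [hx] at hx'
        exact ⟨⟨z.append b, (G.isMem_cons.1 hx').2⟩, [], b, z, by simp [word_nil], rfl, hy⟩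
  | cons e a ih =>
    have hr' : Red a b := by
      intro e' he'
      apply hr e'
      cases a with
      | nil => simp at he'
      | cons f a => simpa using he'
    rw [word_cons, mul_assoc, betaFun_comp]
    · exact betaFun_of_mem e (ih hr')
    · intro x y hl
      rw [← mul_assoc, ← word_cons] at hl
      obtain ⟨z, -, hy⟩ := (G.link_red hr).1 hl
      have hy' := y.2
      rw [hy] at hy'
      exact (link_of (x := ⟨z.append a, (G.isMem_cons.1 hy').2⟩).2 hy).mem

theorem betaFun_mem (t : FreeGroup E) {f : G.PathSpace → R} (hf : f ∈ G.DAlg R) :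
    G.betaFun R t f ∈ G.DAlg R := by
  by_cases h : ∃ y, y ∈ G.Xt t
  · obtain ⟨y, x, a, b, z, rfl, -, -⟩ := h
    obtain ⟨a, b, c, rfl, rfl, hr⟩ := exists_red a b
    have : word (a ++ c) * (word (b ++ c))⁻¹ = word a * (word b)⁻¹ := by
      rw [word_append, word_append]
      group
    rw [this]
    exact betaFun_red_mem hr hf
  · convert zero_mem (G.DAlg R) using 1
    funext y
    exact betaFun_of_notMem (fun hy => h ⟨y, hy⟩) f

variable (G R)

/-- The isomorphism `β_t : D_{t⁻¹} → D_t`. -/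
noncomputable def betaEquiv (t : FreeGroup E) : G.Dt R t⁻¹ ≃ₗ[R] G.Dt R t where
  toFun f := ⟨⟨G.betaFun R t f.1.1, betaFun_mem t f.1.2⟩,
    mem_Dt_iff.2 fun _ hx => betaFun_of_notMem hx _⟩
  invFun f := ⟨⟨G.betaFun R t⁻¹ f.1.1, betaFun_mem t⁻¹ f.1.2⟩,
    mem_Dt_iff.2 fun _ hx => betaFun_of_notMem hx _⟩
  map_add' f g := Subtype.ext <| Subtype.ext <| map_add (G.betaFun R t) f.1.1 g.1.1
  map_smul' c f := Subtype.ext <| Subtype.ext <| map_smul (G.betaFun R t) c f.1.1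
  left_inv f := Subtype.ext <| Subtype.ext <| betaFun_comp_inv (mem_Dt_iff.1 f.2)
  right_inv f := Subtype.ext <| Subtype.ext <| by
    have := betaFun_comp_inv (t := t⁻¹) (f := f.1.1) (by simpa using mem_Dt_iff.1 f.2)
    rwa [inv_inv] at this

/-- The partial action `β` of the free group on the edges on the algebra `D`. -/
noncomputable def beta : AlgPartialAction R (FreeGroup E) (G.DAlg R) where
  D := G.Dt R
  mul_mem_left t a x hx := mem_Dt_iff.2 fun y hy => by
    change a.1 y * x.1 y = 0
    rw [mem_Dt_iff.1 hx y hy, mul_zero]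
  mul_mem_right t a x hx := mem_Dt_iff.2 fun y hy => by
    change x.1 y * a.1 y = 0
    rw [mem_Dt_iff.1 hx y hy, zero_mul]
  α := G.betaEquiv R
  α_mul t f g := Subtype.ext <| betaFun_mul t f.1.1 g.1.1
  D_one := eq_top_iff.2 fun f _ => mem_Dt_iff.2 fun x hx => absurd (by rw [Xt_one]; trivial) hx
  α_one f := Subtype.ext <| funext fun x => betaFun_apply (link_one.2 rfl) f.1.1
  α_mem_iff t s f := by
    rw [mem_Dt_iff, mem_Dt_iff]
    change _ ↔ ∀ y ∉ G.Xt (t * s), G.betaFun R t f.1.1 y = 0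
    constructor
    · intro h y hy
      by_cases hyt : y ∈ G.Xt t
      · obtain ⟨x, hx⟩ := hyt
        rw [betaFun_apply hx]
        exact h x fun hxs => hy ((mem_Xt_mul_iff hx).2 hxs)
      · exact betaFun_of_notMem hyt _
    · intro h x hx
      by_cases hxt : x ∈ G.Xt t⁻¹
      · obtain ⟨y, hy⟩ := hxt
        have hl := link_inv.1 hy
        rw [← betaFun_apply hl f.1.1]
        exact h y fun hys => hx ((mem_Xt_mul_iff hl).1 hys)
      · exact mem_Dt_iff.1 f.2 x hxt
  α_comp t s f h₁ h₂ := by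
    rw [mem_Dt_iff] at h₁ h₂
    have h₃ : ∀ y ∉ G.Xt t⁻¹, G.betaFun R s f.1 y = 0 := by
      intro y hy
      by_cases hys : y ∈ G.Xt s
      · obtain ⟨x, hx⟩ := hys
        rw [betaFun_apply hx]
        apply h₂
        rintro ⟨w, hw⟩
        have := (link_inv.2 hx).comp (link_inv.1 hw)
        rw [mul_inv_cancel_right] at this
        exact hy this.mem_inv
      · exact betaFun_of_notMem hys _
    refine ⟨mem_Dt_iff.2 h₃, Subtype.ext ?_⟩
    change G.betaFun R t (G.betaFun R s f.1) = G.betaFun R (t * s) f.1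
    funext y
    by_cases hy : y ∈ G.Xt t
    · obtain ⟨w, hw⟩ := hy
      rw [betaFun_apply hw]
      by_cases hws : w ∈ G.Xt s
      · obtain ⟨x, hx⟩ := hws
        rw [betaFun_apply hx, betaFun_apply (hx.comp hw)]
      · rw [betaFun_of_notMem hws, betaFun_of_notMem]
        rwa [mem_Xt_mul_iff hw]
    · rw [betaFun_of_notMem hy]
      by_cases hy' : y ∈ G.Xt (t * s)
      · obtain ⟨x, hx⟩ := hy'
        rw [betaFun_apply hx]
        apply (h₁ x · |>.symm)
        rintro ⟨w, hw⟩
        have := hw.comp hx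
        rw [mul_inv_cancel_right] at this
        exact hy this.mem
      · rw [betaFun_of_notMem hy']

/-- The partial skew group ring `D ⋊_β 𝔽`. -/
abbrev SkewRing : Type (max v (max u v) w) := (G.beta R).SkewRing

/-- `1_A`, as an element of `D_1 = D`. -/
noncomputable def oneA (A : G.GenVertex) : (G.beta R).D 1 :=
  ⟨⟨G.chi R (G.XA A.1), chi_XA_mem A.2⟩, (G.beta R).D_one ▸ Submodule.mem_top⟩

/-- `1_t`, as an element of `D_t`, for `t` not the neutral element. -/
noncomputable def oneT (t : FreeGroup E) (ht : t ≠ 1) : (G.beta R).D t :=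
  ⟨⟨G.chi R (G.Xt t), chi_Xt_mem ht⟩, mem_Dt_iff.2 fun _ hx => chi_of_notMem hx⟩

end Algebra

end Ultragraph

/-! Extend `β_t` to all functions on `X` by zero off `X_t`. The product then reads `(a δ_t)(b δ_s) =
a β_t(b) δ_{ts}` (`coe_coeffMul`), which gives associativity and turns each Leavitt relation into an
identity between subsets of `X`. The universal property supplies `φ`.

Surjectivity: the element `s_b p_A s_b^*` goes to `1_{bA} δ_1`, and every nonzero generator of `D`
is some `1_{bA}` with `b` possibly empty, so `D δ_1` is in the image. For `t = a b⁻¹` reduced, `D_t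
δ_t` is reached from degree `1` edge by edge: multiplying by `s_e^*` on the right changes the degree
but not the coefficient, and multiplying by `s_e` on the left applies `β_e`.

Injectivity: the algebra is the sum of the spans of the `s_a p_A s_b^*` with `a b⁻¹ = t`, and `φ`
sends the span of index `t` into `D_t δ_t`; hence a kernel element has each of its components in the
kernel. For `t = a b⁻¹` reduced, such a component is `s_a y s_b^*` with `y` diagonal, that is, a
combination of elements `s_c p_A s_c^*`. Cancelling edges with `s_e^* s_e = p_{r(e)}` reduces the
claim to diagonal elements. As the algebra need not have a unit, multiplication by `s_a` and `s_b^*`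
is treated as a linear map, the identity for the empty path.

A diagonal kernel element is `x = y + ∑ s_e z_e s_e^*`, with `y` a combination of the `p_A` and `f`
the matching function on vertices. By induction on path length the kernel element `s_e^* x s_e`
vanishes, which forces `s_e z_e s_e^* = -f(s(e)) s_e s_e^*`. What remains is `y = ∑_{e ∈ F} f(s(e))
s_e s_e^*` for a finite set `F` of edges (`vertexRep_eq_sum_of_map_eq`). Evaluating on `X` shows
that `f` is nonzero only at vertices that are not sinks and emit edges of `F` only. There are
finitely many of these, so `y = ∑ f(v) p_v` (`VertexRep.eq_sum`), and relation (4) finishes. The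
passage from `f` back to `y` rests on `VertexRep.eq_zero`: a combination of the `p_A` vanishes if
its function does. -/

namespace AlgPartialAction

variable {R : Type u} {G : Type v} {A : Type w} [CommRing R] [Group G] [NonUnitalRing A]
  [Module R A] (P : AlgPartialAction R G A)

theorem SkewRing.induction {p : P.SkewRing → Prop} (x : P.SkewRing) (zero : p 0)
    (delta : ∀ t a, p (P.delta t a)) (add : ∀ x y, p x → p y → p (x + y)) : p x := by
  classical
  refine DirectSum.induction_on x zero (fun t a => ?_) add
  exact delta t a

variable [IsScalarTower R A A] [SMulCommClass R A A]

instance : IsScalarTower R P.SkewRing P.SkewRing where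
  smul_assoc c x y := LinearMap.map_smul₂ P.mulHom c x y

instance : SMulCommClass R P.SkewRing P.SkewRing where
  smul_comm c x y := ((P.mulHom x).map_smul c y).symm

end AlgPartialAction

/-! ### Products and coefficients in the partial skew group ring -/

namespace Ultragraph

variable {V : Type u} {E : Type v} {G : Ultragraph V E} {R : Type w} [CommRing R]

theorem betaFun_one (f : G.PathSpace → R) : G.betaFun R 1 f = f :=
  funext fun _ => betaFun_apply (link_one.2 rfl) f

theorem beta_ext {t : FreeGroup E} {a b : (G.beta R).D t} (h : a.1.1 = b.1.1) : a = b :=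
  Subtype.ext (Subtype.ext h)

/-- `β_t` is multiplicative on all functions, and `β_t β_{t⁻¹} a = a` because `a` vanishes off
`X_t`. -/
theorem coe_coeffMul {t s : FreeGroup E} (a : (G.beta R).D t) (b : (G.beta R).D s) :
    ((G.beta R).coeffMul t s a b).1.1 = a.1.1 * G.betaFun R t b.1.1 := by
  change G.betaFun R t (G.betaFun R t⁻¹ a.1.1 * b.1.1) = _
  rw [betaFun_mul]
  have := betaFun_comp_inv (t := t⁻¹) (f := a.1.1) (by simpa using mem_Dt_iff.1 a.2)
  rw [inv_inv] at this
  rw [this]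

/-- Keeping the degree `u` free up to a proof of `t * s = u` lets coefficients be compared as
functions, with no transport between `D (t * s)` and `D u`. -/
theorem delta_mul_delta_eq {t s u : FreeGroup E} (h : t * s = u) (a : (G.beta R).D t)
    (b : (G.beta R).D s) (c : (G.beta R).D u) (hc : c.1.1 = a.1.1 * G.betaFun R t b.1.1) :
    (G.beta R).delta t a * (G.beta R).delta s b = (G.beta R).delta u c := by
  subst h
  rw [AlgPartialAction.delta_mul_delta]
  exact congrArg _ (beta_ext ((coe_coeffMul a b).trans hc.symm))

theorem delta_congr {t u : FreeGroup E} (h : t = u) (a : (G.beta R).D t) (c : (G.beta R).D u)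
    (hc : a.1.1 = c.1.1) : (G.beta R).delta t a = (G.beta R).delta u c := by
  subst h
  exact congrArg _ (beta_ext hc)

/-- The core of associativity. `β_{ts} f` may be nonzero at points of `X_t` where `β_t β_s f` is
zero by default, namely at `θ_t(x)` with `x` outside `X_s`; the factor `b` vanishes there. -/
theorem mul_betaFun_mul_betaFun {t s : FreeGroup E} {a b : G.PathSpace → R}
    (f : G.PathSpace → R) (hb : ∀ x ∉ G.Xt s, b x = 0) :
    a * G.betaFun R t b * G.betaFun R (t * s) f = a * G.betaFun R t (b * G.betaFun R s f) := by
  funext y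
  by_cases hy : y ∈ G.Xt t
  · obtain ⟨x, hx⟩ := hy
    simp only [Pi.mul_apply, betaFun_apply hx]
    by_cases hs : x ∈ G.Xt s
    · obtain ⟨w, hw⟩ := hs
      rw [betaFun_apply hw, betaFun_apply (hw.comp hx), mul_assoc]
    · simp [hb x hs]
  · simp [betaFun_of_notMem hy]

theorem skewRing_mul_assoc (x y z : G.SkewRing R) : x * y * z = x * (y * z) := by
  induction x using AlgPartialAction.SkewRing.induction with
  | zero => simp
  | add x x' hx hx' => simp only [add_mul, hx, hx']
  | delta t a =>
    induction y using AlgPartialAction.SkewRing.induction with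
    | zero => simp
    | add y y' hy hy' => simp only [add_mul, mul_add, hy, hy']
    | delta s b =>
      induction z using AlgPartialAction.SkewRing.induction with
      | zero => simp
      | add z z' hz hz' => simp only [mul_add, hz, hz']
      | delta r c =>
        simp only [AlgPartialAction.delta_mul_delta]
        refine delta_congr (mul_assoc t s r) _ _ ?_
        simp only [coe_coeffMul]
        exact mul_betaFun_mul_betaFun _ (mem_Dt_iff.1 b.2)

open scoped Classical in
/-- The coefficient of `δ_t`, as a function on the path space. -/
noncomputable def coef (t : FreeGroup E) : G.SkewRing R →ₗ[R] (G.PathSpace → R) :=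
  (G.beta R).lift fun s =>
    if s = t then (G.DAlg R).toSubmodule.subtype ∘ₗ ((G.beta R).D s).subtype else 0

theorem coef_delta_same (t : FreeGroup E) (a : (G.beta R).D t) :
    coef t ((G.beta R).delta t a) = a.1.1 := by
  rw [coef, AlgPartialAction.lift_delta, if_pos rfl]
  rfl

theorem coef_delta_ne {s t : FreeGroup E} (h : s ≠ t) (a : (G.beta R).D s) :
    coef t ((G.beta R).delta s a) = 0 := by
  rw [coef, AlgPartialAction.lift_delta, if_neg h]
  rfl

/-! ### The universal property of the Leavitt path algebra -/

section Lift

variable {S : Type*} [NonUnitalNonAssocRing S] [Module R S]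

variable (G R) in
theorem FreeAlg.exists_lift [IsScalarTower R S S] [SMulCommClass R S S]
    (hassoc : ∀ x y z : S, x * y * z = x * (y * z)) (f : G.Gen → S) :
    ∃ F : G.FreeAlg R →ₙₐ[R] S, ∀ x, F (G.gen R x) = f x := by
  -- The lift out of a free semigroup needs a semigroup, while the skew ring only carries a
  -- non-associative ring instance; hence associativity enters as a hypothesis.
  let _ : Semigroup S := { mul_assoc := hassoc }
  refine ⟨MonoidAlgebra.liftMagma R (FreeSemigroup.lift f), fun x => ?_⟩
  simp [gen]

theorem LeavittAlgebra.exists_lift (F : G.FreeAlg R →ₙₐ[R] S)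
    (hF : ∀ a b, G.LeavittRel R a b → F a = F b) :
    ∃ φ : G.LeavittAlgebra R →ₙₐ[R] S, ∀ x, φ (.mk G R x) = F x := by
  have key : ∀ x y, G.leavittCon R x y → F x = F y := by
    intro x y h
    change RingConGen.Rel _ _ _ at h
    induction h with
    | of x y h =>
      obtain ⟨d, a, b, h, rfl, rfl⟩ := h
      rw [map_smul, map_smul, hF a b h]
    | refl x => rfl
    | symm _ ih => exact ih.symm
    | trans _ _ ih₁ ih₂ => exact ih₁.trans ih₂
    | add _ _ ih₁ ih₂ => rw [map_add, map_add, ih₁, ih₂]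
    | mul _ _ ih₁ ih₂ => rw [map_mul, map_mul, ih₁, ih₂]
  exact ⟨{
    toFun := Quotient.lift F key
    map_smul' := fun c => Quotient.ind fun x => map_smul F c x
    map_zero' := map_zero F
    map_add' := Quotient.ind₂ fun x y => map_add F x y
    map_mul' := Quotient.ind₂ fun x y => map_mul F x y }, fun x => rfl⟩

end Lift

/-! ### Relations in the Leavitt path algebra -/

namespace LeavittAlgebra

theorem mk_eq {a b : G.FreeAlg R} (h : G.LeavittRel R a b) : mk G R a = mk G R b := by
  refine Quotient.sound' ?_
  change RingConGen.Rel _ _ _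
  exact .of _ _ ⟨1, a, b, h, by simp, by simp⟩

theorem mk_sum {ι : Type*} (F : Finset ι) (f : ι → G.FreeAlg R) :
    mk G R (∑ i ∈ F, f i) = ∑ i ∈ F, mk G R (f i) :=
  map_sum (⟨⟨mk G R, rfl⟩, fun _ _ => rfl⟩ : G.FreeAlg R →+ G.LeavittAlgebra R) f F

theorem p_empty : p G R ⟨∅, .empty⟩ = 0 := mk_eq .p_empty

theorem p_mul_p (A B : G.GenVertex) : p G R A * p G R B = p G R ⟨A.1 ∩ B.1, .inter A.2 B.2⟩ :=
  mk_eq (.p_inter A B)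

theorem p_union (A B : G.GenVertex) :
    p G R ⟨A.1 ∪ B.1, .union A.2 B.2⟩ =
      p G R A + p G R B - p G R ⟨A.1 ∩ B.1, .inter A.2 B.2⟩ :=
  mk_eq (.p_union A B)

theorem p_src_mul_s (e : E) : p G R ⟨{G.s e}, .singleton _⟩ * s G R e = s G R e := mk_eq (.p_s e)

theorem s_mul_p_ran (e : E) : s G R e * p G R ⟨G.r e, .range e⟩ = s G R e := mk_eq (.s_p e)

theorem p_ran_mul_sStar (e : E) : p G R ⟨G.r e, .range e⟩ * sStar G R e = sStar G R e :=
  mk_eq (.p_sStar e)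

theorem sStar_mul_p_src (e : E) : sStar G R e * p G R ⟨{G.s e}, .singleton _⟩ = sStar G R e :=
  mk_eq (.sStar_p e)

theorem sStar_mul_s (e : E) : sStar G R e * s G R e = p G R ⟨G.r e, .range e⟩ :=
  mk_eq (.sStar_s e)

theorem sStar_mul_s_of_ne {e f : E} (h : e ≠ f) : sStar G R e * s G R f = 0 :=
  mk_eq (.sStar_s_ne e f h)

theorem p_singleton {v : V} (hne : {e | G.s e = v}.Nonempty) (hfin : {e | G.s e = v}.Finite) :
    p G R ⟨{v}, .singleton v⟩ = ∑ e ∈ hfin.toFinset, s G R e * sStar G R e :=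
  (mk_eq (.p_vertex v hne hfin)).trans (mk_sum _ _)

theorem p_congr {A B : Set V} (h : A = B) (hA : G.IsGenVertex A) (hB : G.IsGenVertex B) :
    p G R ⟨A, hA⟩ = p G R ⟨B, hB⟩ := by
  subst h
  rfl

/-- Insert `p_{s(e)}` next to `s_e`: the intersection `A ∩ {s(e)}` is either `{s(e)}` or empty. The
same argument serves the next three lemmas. -/
theorem p_mul_s_of_mem {A : G.GenVertex} {e : E} (h : G.s e ∈ A.1) :
    p G R A * s G R e = s G R e := by
  conv_lhs => rw [← p_src_mul_s, ← mul_assoc, p_mul_p]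
  rw [p_congr (Set.inter_eq_right.2 (Set.singleton_subset_iff.2 h)) _ (.singleton _), p_src_mul_s]

theorem p_mul_s_of_notMem {A : G.GenVertex} {e : E} (h : G.s e ∉ A.1) :
    p G R A * s G R e = 0 := by
  conv_lhs => rw [← p_src_mul_s, ← mul_assoc, p_mul_p]
  rw [p_congr (Set.inter_singleton_eq_empty.2 h) _ .empty, p_empty, zero_mul]

theorem sStar_mul_p_of_mem {A : G.GenVertex} {e : E} (h : G.s e ∈ A.1) :
    sStar G R e * p G R A = sStar G R e := by
  conv_lhs => rw [← sStar_mul_p_src, mul_assoc, p_mul_p]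
  rw [p_congr (Set.inter_eq_left.2 (Set.singleton_subset_iff.2 h)) _ (.singleton _),
    sStar_mul_p_src]

theorem sStar_mul_p_of_notMem {A : G.GenVertex} {e : E} (h : G.s e ∉ A.1) :
    sStar G R e * p G R A = 0 := by
  conv_lhs => rw [← sStar_mul_p_src, mul_assoc, p_mul_p]
  rw [p_congr (Set.singleton_inter_eq_empty.2 h) _ .empty, p_empty, mul_zero]

/-- Every element is a linear combination of words in the generators. -/
theorem induction_words {P : G.LeavittAlgebra R → Prop} (x : G.LeavittAlgebra R)
    (zero : P 0) (add : ∀ x y, P x → P y → P (x + y)) (smul : ∀ (c : R) x, P x → P (c • x))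
    (gen : ∀ g, P (mk G R (G.gen R g)))
    (gen_mul : ∀ g x, P x → P (mk G R (G.gen R g) * x)) : P x := by
  obtain ⟨x, rfl⟩ : ∃ y, mk G R y = x := Quotient.mk''_surjective x
  have hw : ∀ w : FreeSemigroup G.Gen, P (mk G R (MonoidAlgebra.single w 1)) := by
    intro w
    induction w using FreeSemigroup.recOnMul with
    | ih1 g => exact gen g
    | ih2 g w _ ih =>
      have := gen_mul g _ ih
      change P (mk G R (G.gen R g * _)) at this
      rwa [Ultragraph.gen, MonoidAlgebra.single_mul_single, one_mul] at this
  induction x using MonoidAlgebra.induction_linear with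
  | zero => exact zero
  | add f g hf hg => exact add _ _ hf hg
  | single w c =>
    have := smul c _ (hw w)
    change P (mk G R (c • _)) at this
    rwa [MonoidAlgebra.smul_single, smul_eq_mul, mul_one] at this

end LeavittAlgebra

/-! ### The homomorphism from the Leavitt path algebra to the partial skew group ring -/

/-- By the product formula `1_S δ_t · 1_T δ_s` has coefficient `1_S β_t(1_T)`, the characteristic
function of `S ∩ θ_t(T)`. This reduces products of generators to set identities. -/
theorem delta_chi_mul_delta_chi {t s u : FreeGroup E} (h : t * s = u) {S T U : Set G.PathSpace}
    {a : (G.beta R).D t} {b : (G.beta R).D s} {c : (G.beta R).D u} (ha : a.1.1 = G.chi R S)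
    (hb : b.1.1 = G.chi R T) (hc : c.1.1 = G.chi R U)
    (hU : ∀ y, y ∈ U ↔ y ∈ S ∧ ∃ x ∈ T, G.Link t x y) :
    (G.beta R).delta t a * (G.beta R).delta s b = (G.beta R).delta u c := by
  refine delta_mul_delta_eq h _ _ _ ?_
  rw [ha, hb, hc, betaFun_chi, chi_mul_chi]
  congr 1
  ext y
  exact hU y

theorem mem_Xt_of {e : E} {x : G.PathSpace} :
    x ∈ G.Xt (FreeGroup.of e) ↔ ∃ z : RawPath V E, x.1 = z.cons e := by
  rw [← word_singleton, Xt_word]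
  rfl

theorem mem_Xt_of_inv {e : E} {x : G.PathSpace} :
    x ∈ G.Xt (FreeGroup.of e)⁻¹ ↔ G.src x.1 ∈ G.r e := by
  rw [← word_singleton, Xt_word_inv (G := G) (b := [e]) ⟨by simp, by simp [IsChain]⟩]
  simp [XA, ran]

theorem link_of_inv {e : E} {x y : G.PathSpace} :
    G.Link (FreeGroup.of e)⁻¹ x y ↔ x.1 = y.1.cons e := by
  rw [link_inv, link_of]

theorem mem_XA {A : Set V} {x : G.PathSpace} : x ∈ G.XA A ↔ G.src x.1 ∈ A := Iff.rfl

theorem XbA_nil (A : Set V) : G.XbA [] A = G.XA A := by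
  ext x
  refine ⟨?_, fun h => ⟨x, rfl, h⟩⟩
  rintro ⟨z, hz, h⟩
  obtain rfl : x = z := Subtype.ext hz
  exact h

/-- The only elements of `X` without a first edge are the `([], v)`, whose source is a sink. -/
theorem PathSpace.exists_cons (x : G.PathSpace) (h : ¬ G.IsSink (G.src x.1)) :
    ∃ (e : E) (z : G.PathSpace), x.1 = z.1.cons e := by
  obtain ⟨x, hx⟩ := x
  have key : ∀ e z, x = RawPath.cons e z → ∃ (e : E) (z : G.PathSpace), x = z.1.cons e :=
    fun e z hz => ⟨e, ⟨z, (G.isMem_cons.1 (hz ▸ hx)).2⟩, hz⟩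
  match x with
  | .fin [] v => exact absurd hx.2.1 h
  | .fin (e :: α) v => exact key e (.fin α v) rfl
  | .inf f =>
    refine key (f 0) (.inf fun n => f (n + 1)) ?_
    rw [RawPath.cons]
    congr 1
    funext n
    cases n <;> rfl

theorem src_of_eq_cons {x : RawPath V E} {z : RawPath V E} {e : E} (h : x = z.cons e) :
    G.src x = G.s e := by
  rw [h, src_cons]

variable (G R) in
/-- The images of the generators in the partial skew group ring. -/
noncomputable def skewGen : G.Gen → G.SkewRing R
  | .p A => (G.beta R).delta 1 (G.oneA R A)
  | .s e => (G.beta R).delta (FreeGroup.of e) (G.oneT R _ (FreeGroup.of_ne_one e))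
  | .sStar e => (G.beta R).delta (FreeGroup.of e)⁻¹
      (G.oneT R _ (inv_ne_one.2 (FreeGroup.of_ne_one e)))

theorem chi_union (S T : Set G.PathSpace) :
    G.chi R (S ∪ T) = G.chi R S + G.chi R T - G.chi R (S ∩ T) := by
  classical
  funext x
  by_cases h₁ : x ∈ S <;> by_cases h₂ : x ∈ T <;> simp [chi, h₁, h₂]

/-- As `v` is not a sink, each element of `X` with source `v` has a unique first edge, so `X_{v}` is
the disjoint union of the `X_e`. This is relation (4) on the function side. -/
theorem chi_XA_singleton {v : V} (hne : {e | G.s e = v}.Nonempty)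
    (hfin : {e | G.s e = v}.Finite) :
    G.chi R (G.XA {v}) = ∑ e ∈ hfin.toFinset, G.chi R (G.Xt (FreeGroup.of e)) := by
  funext x
  rw [Finset.sum_apply]
  by_cases hx : G.src x.1 = v
  · rw [chi_of_mem (show x ∈ G.XA {v} from hx)]
    obtain ⟨e, z, hz⟩ := x.exists_cons (by
      obtain ⟨e, he⟩ := hne
      exact fun h => h e (he.trans hx.symm))
    rw [Finset.sum_eq_single e]
    · exact (chi_of_mem (mem_Xt_of.2 ⟨_, hz⟩)).symm
    · intro f _ hf
      refine chi_of_notMem fun h => ?_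
      obtain ⟨w, hw⟩ := mem_Xt_of.1 h
      exact hf (RawPath.cons_inj.1 (hw.symm.trans hz)).1
    · intro h
      refine absurd ?_ h
      simpa [src_of_eq_cons hz] using hx
  · rw [chi_of_notMem (show x ∉ G.XA {v} from hx)]
    refine (Finset.sum_eq_zero fun e he => chi_of_notMem fun h => hx ?_).symm
    obtain ⟨w, hw⟩ := mem_Xt_of.1 h
    rw [src_of_eq_cons hw]
    simpa using he

variable (R) in
/-- An element of `D`, as an element of `D_1`. -/
noncomputable def dOne (f : G.PathSpace → R) (hf : f ∈ G.DAlg R) : (G.beta R).D 1 :=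
  ⟨⟨f, hf⟩, (G.beta R).D_one ▸ Submodule.mem_top⟩

theorem skewGen_s_mul_sStar (e : E) (h : G.chi R (G.Xt (FreeGroup.of e)) ∈ G.DAlg R) :
    G.skewGen R (.s e) * G.skewGen R (.sStar e) =
      (G.beta R).delta 1 (dOne R _ h) := by
  refine delta_chi_mul_delta_chi (mul_inv_cancel _) rfl rfl rfl fun y =>
    ⟨fun hy => ⟨hy, ?_⟩, And.left⟩
  obtain ⟨x, hx⟩ := hy
  exact ⟨x, hx.mem_inv, hx⟩

theorem lift_skewGen_eq (F : G.FreeAlg R →ₙₐ[R] G.SkewRing R)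
    (hF : ∀ x, F (G.gen R x) = G.skewGen R x) {a b : G.FreeAlg R} (h : G.LeavittRel R a b) :
    F a = F b := by
  cases h with
  | p_empty =>
    rw [hF, map_zero, skewGen]
    refine (congrArg _ (beta_ext ?_)).trans (map_zero ((G.beta R).delta 1))
    exact chi_empty
  | p_inter A B =>
    simp only [map_mul, hF]
    exact delta_chi_mul_delta_chi (one_mul 1) rfl rfl rfl fun y => by simp [link_one, mem_XA]
  | p_union A B =>
    simp only [map_add, map_sub, hF]
    simp only [skewGen]
    rw [← map_add, ← map_sub]
    exact congrArg _ (beta_ext (chi_union (G.XA A.1) (G.XA B.1)))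
  | p_s e =>
    simp only [map_mul, hF]
    refine delta_chi_mul_delta_chi (one_mul _) rfl rfl rfl fun y => ?_
    simp only [link_one, mem_XA, exists_eq_right, Set.mem_singleton_iff, mem_Xt_of]
    refine ⟨fun h => ⟨?_, h⟩, And.right⟩
    obtain ⟨z, hz⟩ := h
    exact src_of_eq_cons hz
  | s_p e =>
    simp only [map_mul, hF]
    refine delta_chi_mul_delta_chi (mul_one _) rfl rfl rfl fun y =>
      ⟨fun hy => ⟨hy, ?_⟩, And.left⟩
    obtain ⟨x, hx⟩ := hy
    exact ⟨x, mem_Xt_of_inv.1 hx.mem_inv, hx⟩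
  | p_sStar e =>
    simp only [map_mul, hF]
    refine delta_chi_mul_delta_chi (one_mul _) rfl rfl rfl fun y => ?_
    simp [link_one, mem_XA, mem_Xt_of_inv]
  | sStar_p e =>
    simp only [map_mul, hF]
    refine delta_chi_mul_delta_chi (mul_one _) rfl rfl rfl fun y =>
      ⟨fun hy => ⟨hy, ?_⟩, And.left⟩
    obtain ⟨x, hx⟩ := hy
    exact ⟨x, src_of_eq_cons (link_of_inv.1 hx), hx⟩
  | sStar_s e =>
    simp only [map_mul, hF]
    refine delta_chi_mul_delta_chi (inv_mul_cancel _) rfl rfl rfl fun y => ?_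
    rw [mem_XA, ← mem_Xt_of_inv]
    refine ⟨fun hy => ⟨hy, ?_⟩, And.left⟩
    obtain ⟨x, hx⟩ := hy
    exact ⟨x, by simpa using hx.mem_inv, hx⟩
  | sStar_s_ne e f h =>
    simp only [map_mul, hF, map_zero]
    refine (delta_mul_delta_eq rfl _ _ 0 ?_).trans (map_zero _)
    change 0 = G.chi R _ * G.betaFun R _ (G.chi R _)
    rw [betaFun_chi, chi_mul_chi, ← chi_empty]
    congr 1
    refine (Set.eq_empty_of_forall_notMem ?_).symm
    rintro y ⟨-, x, hx, hl⟩
    obtain ⟨z, hz⟩ := mem_Xt_of.1 hx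
    exact h (RawPath.cons_inj.1 ((link_of_inv.1 hl).symm.trans hz)).1
  | p_vertex v hne hfin =>
    simp only [map_sum, map_mul, hF]
    rw [Finset.sum_congr rfl fun e _ =>
      skewGen_s_mul_sStar e (chi_Xt_mem (FreeGroup.of_ne_one e)), ← map_sum]
    refine congrArg ((G.beta R).delta 1) (beta_ext ?_)
    change G.chi R (G.XA {v}) = _
    rw [chi_XA_singleton hne hfin]
    exact (map_sum ((G.DAlg R).toSubmodule.subtype ∘ₗ ((G.beta R).D 1).subtype)
      (fun e => dOne R _ (chi_Xt_mem (FreeGroup.of_ne_one e))) hfin.toFinset).symm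

variable (G R) in
theorem exists_hom_skewGen : ∃ φ : G.LeavittAlgebra R →ₙₐ[R] G.SkewRing R,
    ∀ x, φ (.mk G R (G.gen R x)) = G.skewGen R x := by
  obtain ⟨F, hF⟩ := FreeAlg.exists_lift G R skewRing_mul_assoc (G.skewGen R)
  obtain ⟨φ, hφ⟩ := LeavittAlgebra.exists_lift F fun a b h => lift_skewGen_eq F hF h
  exact ⟨φ, fun x => (hφ _).trans (hF x)⟩

/-! ### Surjectivity -/

/-- Allowing every list `b` makes induction on `b` possible: the empty list gives `1_A`, and a list
that is not a path gives `0`. -/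
theorem chi_XbA_mem' (b : List E) {A : Set V} (hA : G.IsGenVertex A) :
    G.chi R (G.XbA b A) ∈ G.DAlg R := by
  by_cases hb : b = []
  · subst hb
    rw [XbA_nil]
    exact chi_XA_mem hA
  by_cases hc : G.IsChain b
  · exact chi_XbA_mem ⟨hb, hc⟩ hA
  · convert zero_mem (G.DAlg R) using 1
    rw [← chi_empty]
    congr 1
    refine Set.eq_empty_of_forall_notMem ?_
    rintro y ⟨z, hz, -⟩
    exact hc (G.isMem_append.1 (hz ▸ y.2)).1

theorem isGenVertex_ran {b : List E} (hb : b ≠ []) : G.IsGenVertex (G.ran b) := by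
  obtain ⟨l, e, rfl⟩ := List.eq_nil_or_concat'  b |>.resolve_left hb
  convert IsGenVertex.range (G := G) e
  simp [ran]

/-- So the generators `1_c` add nothing to the `1_{bA}`. For `c = a b⁻¹` reduced with `b` non-empty
take `A = r(b)`: the condition `s(z) ∈ r(a)` is implied by `a z ∈ X`. If `b` is empty, `ran b` is
all of `V`, which need not be a generalized vertex, and `r(a)` is taken; here `c ≠ 1` makes `a`
non-empty. -/
theorem exists_Xt_eq_XbA {c : FreeGroup E} (hc : c ≠ 1) (hne : (G.Xt c).Nonempty) :
    ∃ a A, G.IsGenVertex A ∧ G.Xt c = G.XbA a A := by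
  obtain ⟨y, x, a, b, z, rfl, hx, hy⟩ := hne
  obtain ⟨a, b, k, rfl, rfl, hr⟩ := exists_red a b
  rw [← RawPath.append_append] at hx
  have h : word (a ++ k) * (word (b ++ k))⁻¹ = word a * (word b)⁻¹ := by
    rw [word_append, word_append]
    group
  rw [h] at hc ⊢
  have hb := (G.isMem_append.1 (hx ▸ x.2)).1
  by_cases hb' : b = []
  · subst hb'
    rw [word_nil, inv_one, mul_one] at hc ⊢
    have ha : a ≠ [] := by
      rintro rfl
      exact hc rfl
    refine ⟨a, G.ran a, isGenVertex_ran ha, ?_⟩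
    rw [Xt_word]
    ext w
    constructor
    · rintro ⟨z, hz⟩
      have := G.isMem_append.1 (hz ▸ w.2)
      exact ⟨⟨z, this.2.2⟩, hz, this.2.1⟩
    · rintro ⟨z, hz, -⟩
      exact ⟨z.1, hz⟩
  · refine ⟨a, G.ran b, isGenVertex_ran hb', ?_⟩
    ext w
    constructor
    · rintro ⟨x, hl⟩
      obtain ⟨z, hz, hw⟩ := (G.link_red hr).1 hl
      have := G.isMem_append.1 (hz ▸ x.2)
      exact ⟨⟨z, this.2.2⟩, hw, this.2.1⟩
    · rintro ⟨z, hw, hz⟩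
      exact ⟨⟨z.1.append b, G.isMem_append.2 ⟨hb, hz, z.2⟩⟩, a, b, z.1, rfl, rfl, hw⟩

section Surjective

variable {φ : G.LeavittAlgebra R →ₙₐ[R] G.SkewRing R}

/-- Left multiplication by `s_e` sends `a δ_t` to `β_e(a) δ_{et}`; the factor `1_e` is absorbed
because `β_e(a)` vanishes off `X_e`. -/
theorem delta_mem_range_of_mul (hφ : ∀ x, φ (.mk G R (G.gen R x)) = G.skewGen R x)
    {e : E} {t u : FreeGroup E} (hu : FreeGroup.of e * t = u)
    {a : (G.beta R).D t} (ha : (G.beta R).delta t a ∈ Set.range φ) (c : (G.beta R).D u)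
    (hc : c.1.1 = G.betaFun R (FreeGroup.of e) a.1.1) :
    (G.beta R).delta u c ∈ Set.range φ := by
  obtain ⟨x, hx⟩ := ha
  refine ⟨.s G R e * x, ?_⟩
  rw [map_mul, hx, LeavittAlgebra.s, hφ]
  refine delta_mul_delta_eq hu _ _ _ ?_
  rw [hc]
  exact (chi_mul_eq_self fun y hy => betaFun_of_notMem hy _).symm

/-- Right multiplication by `s_e^*` multiplies the coefficient by `1_t 1_u`, which does nothing to a
function vanishing off `X_t` and off `X_u`. Only the degree moves. -/
theorem delta_mem_range_of_mul_inv (hφ : ∀ x, φ (.mk G R (G.gen R x)) = G.skewGen R x)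
    {e : E} {t u : FreeGroup E} (hu : t * (FreeGroup.of e)⁻¹ = u)
    {a : (G.beta R).D t} (ha : (G.beta R).delta t a ∈ Set.range φ) (c : (G.beta R).D u)
    (hc : c.1.1 = a.1.1) : (G.beta R).delta u c ∈ Set.range φ := by
  obtain ⟨x, hx⟩ := ha
  refine ⟨x * .sStar G R e, ?_⟩
  rw [map_mul, hx, LeavittAlgebra.sStar, hφ]
  refine delta_mul_delta_eq hu _ _ _ ?_
  change _ = _ * G.betaFun R t (G.chi R _)
  have ha : c.1.1 * G.chi R (G.Xt t) = c.1.1 := by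
    rw [hc, mul_comm]
    exact chi_mul_eq_self (mem_Dt_iff.1 a.2)
  rw [betaFun_chi_Xt, hu, ← hc, ← mul_assoc, ha, mul_comm]
  exact (chi_mul_eq_self (mem_Dt_iff.1 c.2)).symm

/-- Since `1_{ebA} = β_e(1_{bA})`, multiplying by `s_e` on the left gives `1_{ebA} δ_e`, and
multiplying by `s_e^*` on the right returns to degree `1`. -/
theorem delta_dOne_chi_XbA_mem_range (hφ : ∀ x, φ (.mk G R (G.gen R x)) = G.skewGen R x)
    (b : List E) {A : Set V} (hA : G.IsGenVertex A) :
    (G.beta R).delta 1 (dOne R _ (chi_XbA_mem' b hA)) ∈ Set.range φ := by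
  induction b with
  | nil =>
    refine ⟨.p G R ⟨A, hA⟩, ?_⟩
    rw [LeavittAlgebra.p, hφ, skewGen]
    refine congrArg _ (beta_ext ?_)
    exact congrArg (G.chi R) (XbA_nil A).symm
  | cons e b ih =>
    have h : G.betaFun R (FreeGroup.of e) (G.chi R (G.XbA b A)) =
        G.chi R (G.XbA (e :: b) A) := by
      rw [betaFun_chi]
      congr 1
      ext y
      constructor
      · rintro ⟨x, ⟨z, hz, hA⟩, hl⟩
        exact ⟨z, by rw [link_of.1 hl, hz]; rfl, hA⟩
      · rintro ⟨z, hz, hA⟩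
        have hz' : y.1 = (z.1.append b).cons e := hz
        exact ⟨⟨z.1.append b, (G.isMem_cons.1 (hz' ▸ y.2)).2⟩, ⟨z, rfl, hA⟩, link_of.2 hz⟩
    refine delta_mem_range_of_mul_inv hφ (mul_inv_cancel (FreeGroup.of e))
      (a := ⟨dOne R _ (chi_XbA_mem' (e :: b) hA), mem_Dt_iff.2 fun y hy => ?_⟩) ?_ _ rfl
    · change G.chi R _ y = 0
      rw [← h]
      exact betaFun_of_notMem hy _
    · exact delta_mem_range_of_mul hφ (mul_one _) ih _ h.symm

theorem delta_dOne_mem_range (hφ : ∀ x, φ (.mk G R (G.gen R x)) = G.skewGen R x)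
    {f : G.PathSpace → R} (hf : f ∈ G.DAlg R) :
    (G.beta R).delta 1 (dOne R f hf) ∈ Set.range φ := by
  induction hf using NonUnitalAlgebra.adjoin_induction with
  | mem f hf =>
    obtain ⟨b, A, hA, h⟩ | rfl :
        (∃ b A, G.IsGenVertex A ∧ f = G.chi R (G.XbA b A)) ∨ f = 0 := by
      obtain (⟨A, hA, rfl⟩ | ⟨b, A, hb, hA, rfl⟩) | ⟨c, hc, rfl⟩ := hf
      · exact .inl ⟨[], A, hA, by rw [XbA_nil]⟩
      · exact .inl ⟨b, A, hA, rfl⟩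
      · obtain hne | hne := (G.Xt c).eq_empty_or_nonempty
        · exact .inr (by rw [hne, chi_empty])
        · obtain ⟨a, A, hA, h⟩ := exists_Xt_eq_XbA hc hne
          exact .inl ⟨a, A, hA, by rw [h]⟩
    · subst h
      exact delta_dOne_chi_XbA_mem_range hφ b hA
    · exact ⟨0, (map_zero φ).trans (map_zero _).symm⟩
  | zero => exact ⟨0, (map_zero φ).trans (map_zero _).symm⟩
  | add f g hf hg ihf ihg =>
    obtain ⟨x, hx⟩ := ihf
    obtain ⟨y, hy⟩ := ihg
    refine ⟨x + y, ?_⟩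
    rw [map_add, hx, hy, ← map_add]
    rfl
  | smul c f hf ihf =>
    obtain ⟨x, hx⟩ := ihf
    refine ⟨c • x, ?_⟩
    rw [map_smul, hx, ← map_smul]
    rfl
  | mul f g hf hg ihf ihg =>
    obtain ⟨x, hx⟩ := ihf
    obtain ⟨y, hy⟩ := ihg
    refine ⟨x * y, ?_⟩
    rw [map_mul, hx, hy]
    refine delta_mul_delta_eq (one_mul 1) _ _ _ ?_
    rw [betaFun_one]
    rfl

/-- If `e b z ∈ X` then `b z ∈ X`, so `X_{(eb)⁻¹} ⊆ X_{b⁻¹}`: the coefficient already lies in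
`D_{b⁻¹}`, and `s_e^*` on the right shifts the degree. -/
theorem delta_inv_word_mem_range (hφ : ∀ x, φ (.mk G R (G.gen R x)) = G.skewGen R x)
    (b : List E) (c : (G.beta R).D (word b)⁻¹) :
    (G.beta R).delta (word b)⁻¹ c ∈ Set.range φ := by
  induction b with
  | nil =>
    rw [delta_congr (by rw [word_nil, inv_one]) c (dOne R _ c.1.2) rfl]
    exact delta_dOne_mem_range hφ _
  | cons e b ih =>
    refine delta_mem_range_of_mul_inv hφ (t := (word b)⁻¹) (by rw [word_cons, mul_inv_rev])
      (a := ⟨c.1, mem_Dt_iff.2 fun y hy => mem_Dt_iff.1 c.2 y fun h => hy ?_⟩) (ih _) c rfl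
    obtain ⟨x, hx⟩ := h
    rw [← one_mul (word (e :: b))⁻¹, ← word_nil] at hx
    obtain ⟨z, hz, hy'⟩ := (G.link_red (by simp [Red])).1 hx
    have hz' : x.1 = (z.append b).cons e := hz
    exact ⟨⟨z.append b, (G.isMem_cons.1 (hz' ▸ x.2)).2⟩, [], b, z, by simp [word_nil], rfl, hy'⟩

theorem delta_red_mem_range (hφ : ∀ x, φ (.mk G R (G.gen R x)) = G.skewGen R x)
    {a b : List E} (hr : Red a b) (c : (G.beta R).D (word a * (word b)⁻¹)) :
    (G.beta R).delta _ c ∈ Set.range φ := by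
  induction a with
  | nil =>
    rw [delta_congr (u := (word b)⁻¹) (by rw [word_nil, one_mul]) c
      ⟨c.1, by simpa [word_nil] using c.2⟩ rfl]
    exact delta_inv_word_mem_range hφ b _
  | cons e a ih =>
    have hr' : Red a b := by
      intro e' he'
      apply hr e'
      cases a with
      | nil => simp at he'
      | cons f a => simpa using he'
    -- Reducedness is essential here: it makes every element of `X_t` begin with `e`, so that `c =
    -- β_e(β_{e⁻¹}(c))` and `β_{e⁻¹}(c)` is a coefficient for the shorter word.
    have hsub : ∀ y ∉ G.Xt (FreeGroup.of e), c.1.1 y = 0 := by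
      intro y hy
      refine mem_Dt_iff.1 c.2 y fun h => hy ?_
      obtain ⟨x, hx⟩ := h
      obtain ⟨z, -, hz⟩ := (G.link_red hr).1 hx
      exact mem_Xt_of.2 ⟨_, hz⟩
    refine delta_mem_range_of_mul hφ (e := e) (t := word a * (word b)⁻¹)
      (by rw [word_cons, mul_assoc])
      (a := ⟨⟨G.betaFun R (FreeGroup.of e)⁻¹ c.1.1, betaFun_mem _ c.1.2⟩,
        mem_Dt_iff.2 fun x hx => ?_⟩) (ih hr' _) c ?_
    · change G.betaFun R _ _ x = 0
      by_cases hxe : x ∈ G.Xt (FreeGroup.of e)⁻¹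
      · obtain ⟨y, hy⟩ := hxe
        rw [betaFun_apply hy]
        refine mem_Dt_iff.1 c.2 y fun h => hx ?_
        rwa [word_cons, mul_assoc, mem_Xt_mul_iff (link_inv.1 hy)] at h
      · exact betaFun_of_notMem hxe _
    · have := betaFun_comp_inv (t := (FreeGroup.of e)⁻¹) (f := c.1.1) (by rwa [inv_inv])
      rw [inv_inv] at this
      exact this.symm

theorem surjective_of_skewGen (hφ : ∀ x, φ (.mk G R (G.gen R x)) = G.skewGen R x) :
    Function.Surjective φ := by
  intro y
  induction y using AlgPartialAction.SkewRing.induction with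
  | zero => exact ⟨0, map_zero φ⟩
  | add y z hy hz =>
    obtain ⟨y, rfl⟩ := hy
    obtain ⟨z, rfl⟩ := hz
    exact ⟨y + z, map_add φ y z⟩
  | delta t c =>
    obtain h | ⟨y, x, a, b, z, rfl, -⟩ := (G.Xt t).eq_empty_or_nonempty
    · refine ⟨0, (map_zero φ).trans ?_⟩
      rw [show c = 0 from beta_ext (funext fun y => mem_Dt_iff.1 c.2 y (by simp [h])), map_zero]
    · obtain ⟨a, b, k, rfl, rfl, hr⟩ := exists_red a b
      have h : word (a ++ k) * (word (b ++ k))⁻¹ = word a * (word b)⁻¹ := by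
        rw [word_append, word_append]
        group
      rw [delta_congr h c ⟨c.1, h ▸ c.2⟩ rfl]
      exact delta_red_mem_range hφ hr _

end Surjective

namespace LeavittAlgebra

/-! ### Linear combinations of the `p_A` -/

/-- A linear combination of the `p_A` with the corresponding combination of the characteristic
functions of the `A`. -/
inductive VertexRep : G.LeavittAlgebra R → (V → R) → Prop
  | of_p (A : G.GenVertex) : VertexRep (p G R A) (A.1.indicator fun _ => 1)
  | zero : VertexRep 0 0
  | add {x y : G.LeavittAlgebra R} {f g : V → R} :
      VertexRep x f → VertexRep y g → VertexRep (x + y) (f + g)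
  | smul (c : R) {x : G.LeavittAlgebra R} {f : V → R} : VertexRep x f → VertexRep (c • x) (c • f)

theorem VertexRep.sum {ι : Type*} (F : Finset ι) {x : ι → G.LeavittAlgebra R} {f : ι → V → R}
    (h : ∀ i ∈ F, VertexRep (x i) (f i)) : VertexRep (∑ i ∈ F, x i) (∑ i ∈ F, f i) := by
  classical
  induction F using Finset.induction_on with
  | empty => exact .zero
  | insert i F hi ih =>
    rw [Finset.sum_insert hi, Finset.sum_insert hi]
    exact .add (h i (by simp)) (ih fun j hj => h j (by simp [hj]))

theorem VertexRep.exists_list {x : G.LeavittAlgebra R} {f : V → R} (h : VertexRep x f) :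
    ∃ l : List (R × G.GenVertex), x = (l.map fun i => i.1 • p G R i.2).sum ∧
      f = (l.map fun i => i.1 • i.2.1.indicator fun _ => 1).sum := by
  induction h with
  | of_p A => exact ⟨[(1, A)], by simp, by simp⟩
  | zero => exact ⟨[], rfl, rfl⟩
  | add _ _ ihx ihy =>
    obtain ⟨l, rfl, rfl⟩ := ihx
    obtain ⟨m, rfl, rfl⟩ := ihy
    exact ⟨l ++ m, by simp, by simp⟩
  | smul c _ ih =>
    obtain ⟨l, rfl, rfl⟩ := ih
    refine ⟨l.map fun i => (c * i.1, i.2), ?_, ?_⟩ <;>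
      simp [List.smul_sum, Function.comp_def, mul_smul]

/-- `p_B - p_B p_C` plays the part of `p_{B \ C}`, but `B \ C` need not be a generalized vertex. -/
noncomputable def pDiff (B C : G.GenVertex) : G.LeavittAlgebra R := p G R B - p G R B * p G R C

theorem p_mul_comm (A B : G.GenVertex) : p G R A * p G R B = p G R B * p G R A := by
  rw [p_mul_p, p_mul_p]
  exact p_congr (Set.inter_comm _ _) _ _

theorem p_mul_p_of_subset {A B : G.GenVertex} (h : A.1 ⊆ B.1) : p G R A * p G R B = p G R A := by
  rw [p_mul_p]
  exact p_congr (Set.inter_eq_left.2 h) _ _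

theorem p_union' (A B : G.GenVertex) : p G R ⟨A.1 ∪ B.1, .union A.2 B.2⟩ =
    p G R A + p G R B - p G R A * p G R B := by
  rw [p_union, p_mul_p]

theorem pDiff_eq_zero {B C : G.GenVertex} (h : B.1 ⊆ C.1) : pDiff (R := R) B C = 0 := by
  rw [pDiff, p_mul_p_of_subset h, sub_self]

/-- `B \ C` is the disjoint union of its part inside `A`, which is `(A ∩ B) \ C`, and its part
outside `A`, which is `B \ (A ∪ C)`. -/
theorem pDiff_split (A B C : G.GenVertex) : pDiff (R := R) B C =
    pDiff ⟨A.1 ∩ B.1, .inter A.2 B.2⟩ C + pDiff B ⟨A.1 ∪ C.1, .union A.2 C.2⟩ := by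
  simp only [pDiff, p_union', ← p_mul_p]
  rw [p_mul_comm A B]
  noncomm_ring

theorem p_mul_pDiff_inter (A B C : G.GenVertex) :
    p G R A * pDiff ⟨A.1 ∩ B.1, .inter A.2 B.2⟩ C = pDiff ⟨A.1 ∩ B.1, .inter A.2 B.2⟩ C := by
  have h : p G R A * p G R A = p G R A := p_mul_p_of_subset subset_rfl
  simp only [pDiff, ← p_mul_p, mul_sub, ← mul_assoc, h]

theorem p_mul_pDiff_union (A B C : G.GenVertex) :
    p G R A * pDiff B ⟨A.1 ∪ C.1, .union A.2 C.2⟩ = 0 := by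
  have h : p G R A * p G R A = p G R A := p_mul_p_of_subset subset_rfl
  simp only [pDiff, p_union', mul_sub, mul_add, ← mul_assoc]
  rw [mul_assoc _ (p G R B) (p G R A), p_mul_comm B A, ← mul_assoc, h]
  simp

/-- The sets of the list cut `B \ C` into cells one after the other, and `c` accumulates the
coefficients of those already used that contain the cell: `p_A` acts as the identity on the part
inside `A` and as zero on the part outside. Once the list is exhausted, a cell is either empty, so
that its `pDiff` is zero, or contains a vertex, so that `c = 0`. -/
theorem sum_p_mul_pDiff_eq_zero (l : List (R × G.GenVertex)) (c : R) (B C : G.GenVertex)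
    (h : ∀ v ∈ B.1 \ C.1, c + (l.map fun i => i.1 * i.2.1.indicator (fun _ => 1) v).sum = 0) :
    c • pDiff B C + (l.map fun i => i.1 • p G R i.2).sum * pDiff B C = 0 := by
  induction l generalizing c B C with
  | nil =>
    simp only [List.map_nil, List.sum_nil, add_zero, zero_mul] at h ⊢
    by_cases hBC : B.1 ⊆ C.1
    · rw [pDiff_eq_zero hBC, smul_zero]
    · obtain ⟨v, hv⟩ := Set.not_subset.1 hBC
      rw [h v hv, zero_smul]
  | cons i l ih =>
    obtain ⟨d, A⟩ := i
    simp only [List.map_cons, List.sum_cons] at h ⊢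
    have h₁ := ih (c + d) ⟨A.1 ∩ B.1, .inter A.2 B.2⟩ C fun v hv => by
      have := h v ⟨hv.1.2, hv.2⟩
      rwa [Set.indicator_of_mem hv.1.1, mul_one, ← add_assoc] at this
    have h₂ := ih c B ⟨A.1 ∪ C.1, .union A.2 C.2⟩ fun v hv => by
      have := h v ⟨hv.1, fun hC => hv.2 (.inr hC)⟩
      rwa [Set.indicator_of_notMem fun hA => hv.2 (.inl hA), mul_zero, zero_add] at this
    rw [pDiff_split A B C]
    simp only [add_mul, mul_add, smul_add, smul_mul_assoc, p_mul_pDiff_inter, p_mul_pDiff_union,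
      smul_zero]
    rw [add_smul] at h₁
    have := congrArg₂ (· + ·) h₁ h₂
    simp only [add_zero] at this
    refine Eq.trans ?_ this
    abel

theorem VertexRep.eq_zero {x : G.LeavittAlgebra R} (h : VertexRep x 0) : x = 0 := by
  obtain ⟨l, rfl, hl⟩ := h.exists_list
  -- A substitute for the unit: `p_B` fixes the whole combination when `B` contains all its sets.
  have hB : ∃ B : G.GenVertex, ∀ i ∈ l, i.2.1 ⊆ B.1 := by
    clear h hl
    induction l with
    | nil => exact ⟨⟨∅, .empty⟩, by simp⟩
    | cons i l ih =>
      obtain ⟨B, hB⟩ := ih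
      refine ⟨⟨i.2.1 ∪ B.1, .union i.2.2 B.2⟩, fun j hj => ?_⟩
      obtain rfl | hj := List.mem_cons.1 hj
      · exact Set.subset_union_left
      · exact (hB j hj).trans Set.subset_union_right
  obtain ⟨B, hB⟩ := hB
  have key := sum_p_mul_pDiff_eq_zero l 0 B ⟨∅, .empty⟩ fun v _ => by
    have := congrFun hl v
    rw [Pi.list_sum_apply, List.map_map] at this
    rw [zero_add]
    exact this.symm
  rw [zero_smul, zero_add, pDiff, p_empty, mul_zero, sub_zero, ← List.sum_map_mul_right] at key
  rw [← key]
  congr 1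
  refine List.map_congr_left fun i hi => ?_
  rw [smul_mul_assoc, p_mul_p_of_subset (hB i hi)]

theorem VertexRep.unique {x y : G.LeavittAlgebra R} {f : V → R} (hx : VertexRep x f)
    (hy : VertexRep y f) : x = y := by
  have := hx.add (hy.smul (-1))
  rw [neg_one_smul, neg_one_smul, add_neg_cancel, ← sub_eq_add_neg] at this
  exact sub_eq_zero.1 this.eq_zero

/-- Both sides represent the same function, so uniqueness applies. -/
theorem VertexRep.eq_sum {x : G.LeavittAlgebra R} {f : V → R} (h : VertexRep x f)
    (S : Finset V) (hS : ∀ v ∉ S, f v = 0) :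
    x = ∑ v ∈ S, f v • p G R ⟨{v}, .singleton v⟩ := by
  classical
  have hsum := VertexRep.sum S fun v _ => (VertexRep.of_p (G := G) ⟨{v}, .singleton v⟩).smul (f v)
  have : ∑ v ∈ S, f v • ({v} : Set V).indicator (fun _ => (1 : R)) = f := by
    funext w
    simp only [Finset.sum_apply, Pi.smul_apply, Set.indicator_apply, Set.mem_singleton_iff,
      smul_eq_mul, mul_ite, mul_one, mul_zero, Finset.sum_ite_eq]
    split_ifs with hw
    · rfl
    · exact (hS w hw).symm
  rw [this] at hsum
  exact h.unique hsum

/-- Conjugation evaluates the function at `s(e)`: `s_e^* p_A s_e` is `p_{r(e)}` or `0` according to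
whether `s(e) ∈ A`. -/
theorem VertexRep.conj {x : G.LeavittAlgebra R} {f : V → R} (h : VertexRep x f) (e : E) :
    sStar G R e * x * s G R e = f (G.s e) • p G R ⟨G.r e, .range e⟩ := by
  induction h with
  | of_p A =>
    by_cases hA : G.s e ∈ A.1
    · rw [sStar_mul_p_of_mem hA, sStar_mul_s, Set.indicator_of_mem hA, one_smul]
    · rw [sStar_mul_p_of_notMem hA, zero_mul, Set.indicator_of_notMem hA, zero_smul]
  | zero => simp
  | add _ _ ihx ihy => rw [mul_add, add_mul, ihx, ihy, Pi.add_apply, add_smul]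
  | smul c _ ih => rw [mul_smul_comm, smul_mul_assoc, ih, Pi.smul_apply, smul_eq_mul, mul_smul]

theorem VertexRep.p_mul {x : G.LeavittAlgebra R} {f : V → R} (h : VertexRep x f)
    (A : G.GenVertex) : ∃ g, VertexRep (p G R A * x) g := by
  induction h with
  | of_p B => exact ⟨_, by rw [p_mul_p]; exact .of_p _⟩
  | zero => exact ⟨0, by rw [mul_zero]; exact .zero⟩
  | add _ _ ihx ihy =>
    obtain ⟨f, hf⟩ := ihx
    obtain ⟨g, hg⟩ := ihy
    exact ⟨f + g, by rw [mul_add]; exact hf.add hg⟩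
  | smul c _ ih =>
    obtain ⟨f, hf⟩ := ih
    exact ⟨c • f, by rw [mul_smul_comm]; exact hf.smul c⟩

theorem VertexRep.commute {x : G.LeavittAlgebra R} {f : V → R} (h : VertexRep x f)
    (A : G.GenVertex) : p G R A * x = x * p G R A := by
  induction h with
  | of_p B => exact p_mul_comm A B
  | zero => simp
  | add _ _ ihx ihy => rw [mul_add, add_mul, ihx, ihy]
  | smul c _ ih => rw [mul_smul_comm, smul_mul_assoc, ih]

/-! ### The diagonal -/

variable (G R) in
/-- The map `x ↦ s_e x s_e^*`. -/
noncomputable def conjS (e : E) : G.LeavittAlgebra R →ₗ[R] G.LeavittAlgebra R where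
  toFun x := s G R e * x * sStar G R e
  map_add' x y := by rw [mul_add, add_mul]
  map_smul' c x := by rw [mul_smul_comm, smul_mul_assoc]; rfl

variable (G R) in
/-- The span of the `s_a p_A s_a^*` with `a` of length at most `n`. -/
noncomputable def diag : ℕ → Submodule R (G.LeavittAlgebra R)
  | 0 => Submodule.span R (Set.range (p G R))
  | n + 1 => Submodule.span R (Set.range (p G R)) ⊔ ⨆ e, (diag n).map (conjS G R e)

theorem exists_vertexRep_iff {x : G.LeavittAlgebra R} :
    x ∈ diag G R 0 ↔ ∃ f, VertexRep x f := by
  constructor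
  · intro h
    induction h using Submodule.span_induction with
    | mem x hx =>
      obtain ⟨A, rfl⟩ := hx
      exact ⟨_, .of_p A⟩
    | zero => exact ⟨0, .zero⟩
    | add x y _ _ hx hy =>
      obtain ⟨f, hf⟩ := hx
      obtain ⟨g, hg⟩ := hy
      exact ⟨_, hf.add hg⟩
    | smul c x _ hx =>
      obtain ⟨f, hf⟩ := hx
      exact ⟨_, hf.smul c⟩
  · rintro ⟨f, h⟩
    induction h with
    | of_p A => exact Submodule.subset_span ⟨A, rfl⟩
    | zero => exact zero_mem _
    | add _ _ ihx ihy => exact add_mem ihx ihy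
    | smul c _ ih => exact Submodule.smul_mem _ c ih

theorem conjS_mem_diag {n : ℕ} {x : G.LeavittAlgebra R} (h : x ∈ diag G R n) (e : E) :
    s G R e * x * sStar G R e ∈ diag G R (n + 1) :=
  le_sup_right (a := Submodule.span R (Set.range (p G R)))
    (Submodule.mem_iSup_of_mem e ⟨x, h, rfl⟩)

theorem diag_zero_le (n : ℕ) : diag G R 0 ≤ diag G R n := by
  cases n with
  | zero => exact le_rfl
  | succ n => exact le_sup_left

/-- Every element of the diagonal is `y + ∑ s_e z_e s_e^*` with `y` a combination of the `p_A`. -/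
theorem exists_of_mem_diag_succ {n : ℕ} {x : G.LeavittAlgebra R} (h : x ∈ diag G R (n + 1)) :
    ∃ y f, VertexRep y f ∧ ∃ z : E →₀ G.LeavittAlgebra R, (∀ e, z e ∈ diag G R n) ∧
      x = y + z.sum fun e w => s G R e * w * sStar G R e := by
  obtain ⟨y, hy, w, hw, rfl⟩ := Submodule.mem_sup.1 h
  obtain ⟨f, hf⟩ := exists_vertexRep_iff.1 hy
  refine ⟨y, f, hf, ?_⟩
  suffices ∃ z : E →₀ G.LeavittAlgebra R, (∀ e, z e ∈ diag G R n) ∧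
      w = z.sum fun e w => s G R e * w * sStar G R e by
    obtain ⟨z, hz, rfl⟩ := this
    exact ⟨z, hz, rfl⟩
  clear h
  classical
  induction hw using Submodule.iSup_induction' with
  | mem e x hx =>
    obtain ⟨x, hx, rfl⟩ := hx
    refine ⟨Finsupp.single e x, fun f => ?_, ?_⟩
    · rw [Finsupp.single_apply]
      split_ifs
      · exact hx
      · exact zero_mem _
    · rw [Finsupp.sum_single_index (by simp)]
      rfl
  | zero => exact ⟨0, fun e => zero_mem _, by simp⟩
  | add x y _ _ hx hy =>
    obtain ⟨z, hz, rfl⟩ := hx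
    obtain ⟨w, hw, rfl⟩ := hy
    refine ⟨z + w, fun e => add_mem (hz e) (hw e), ?_⟩
    rw [Finsupp.sum_add_index' (by simp) (fun e x y => by rw [mul_add, add_mul])]

theorem sStar_mul_conj_mul_s_self (e : E) (w : G.LeavittAlgebra R) :
    sStar G R e * (s G R e * w * sStar G R e) * s G R e =
      p G R ⟨G.r e, .range e⟩ * w * p G R ⟨G.r e, .range e⟩ := by
  rw [← sStar_mul_s]
  simp only [mul_assoc]

theorem sStar_mul_conj_mul_s_of_ne {e f : E} (h : e ≠ f) (w : G.LeavittAlgebra R) :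
    sStar G R e * (s G R f * w * sStar G R f) * s G R e = 0 := by
  simp only [← mul_assoc]
  rw [sStar_mul_s_of_ne h]
  simp

theorem conj_p_ran_mul (e : E) (w : G.LeavittAlgebra R) :
    s G R e * (p G R ⟨G.r e, .range e⟩ * w * p G R ⟨G.r e, .range e⟩) * sStar G R e =
      s G R e * w * sStar G R e := by
  simp only [← mul_assoc]
  rw [s_mul_p_ran, mul_assoc _ (p G R _), p_ran_mul_sStar]

/-- On either side of `s_e z s_e^*`, the factor `p_A` is absorbed if `s(e) ∈ A` and kills it
otherwise. -/
theorem p_mul_mem_diag {n : ℕ} {x : G.LeavittAlgebra R} (h : x ∈ diag G R n) (A : G.GenVertex) :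
    p G R A * x ∈ diag G R n ∧ p G R A * x = x * p G R A := by
  cases n with
  | zero =>
    obtain ⟨f, hf⟩ := exists_vertexRep_iff.1 h
    exact ⟨exists_vertexRep_iff.2 (hf.p_mul A), hf.commute A⟩
  | succ n =>
    obtain ⟨y, f, hf, z, hz, rfl⟩ := exists_of_mem_diag_succ h
    have key : ∀ e, p G R A * (s G R e * z e * sStar G R e) ∈ diag G R (n + 1) ∧
        p G R A * (s G R e * z e * sStar G R e) = s G R e * z e * sStar G R e * p G R A := by
      intro e
      rw [mul_assoc _ _ (p G R A)]
      by_cases hA : G.s e ∈ A.1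
      · rw [sStar_mul_p_of_mem hA, ← mul_assoc, ← mul_assoc, p_mul_s_of_mem hA]
        exact ⟨conjS_mem_diag (hz e) e, rfl⟩
      · rw [sStar_mul_p_of_notMem hA, ← mul_assoc, ← mul_assoc, p_mul_s_of_notMem hA]
        simp
    rw [mul_add, add_mul, Finsupp.sum, Finset.mul_sum, Finset.sum_mul, hf.commute]
    refine ⟨add_mem ?_ (sum_mem fun e _ => (key e).1), ?_⟩
    · rw [← hf.commute]
      exact diag_zero_le _ (exists_vertexRep_iff.2 (hf.p_mul A))
    · rw [Finset.sum_congr rfl fun e _ => (key e).2]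

end LeavittAlgebra

/-! ### Injectivity -/

theorem exists_src_eq_of_isSink {v : V} (h : G.IsSink v) : ∃ x : G.PathSpace, G.src x.1 = v :=
  ⟨⟨.fin [] v, by simp [IsChain], h, by simp [ran]⟩, rfl⟩

/-- A vertex at which no element of `X` starts is not a sink, and every vertex in the range of an
edge it emits has the same defect, since that edge could be prepended. Following such edges forever
builds an infinite path from `v`, a contradiction. -/
theorem exists_src_eq (v : V) : ∃ x : G.PathSpace, G.src x.1 = v := by
  by_contra hv
  have key (v : {v : V // ¬ ∃ x : G.PathSpace, G.src x.1 = v}) :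
      ∃ (e : E) (w : {v : V // ¬ ∃ x : G.PathSpace, G.src x.1 = v}),
        G.s e = v.1 ∧ w.1 ∈ G.r e := by
    have hs : ¬ G.IsSink v.1 := fun h => v.2 (exists_src_eq_of_isSink h)
    simp only [IsSink, not_forall, not_not] at hs
    obtain ⟨e, he⟩ := hs
    obtain ⟨w, hw⟩ := G.r_nonempty e
    refine ⟨e, ⟨w, ?_⟩, he, hw⟩
    rintro ⟨z, rfl⟩
    exact v.2 ⟨⟨z.1.cons e, G.isMem_cons.2 ⟨hw, z.2⟩⟩, (src_cons G e z.1).trans he⟩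
  choose edge next hs hr using key
  refine hv ⟨⟨.inf fun n => edge (next^[n] ⟨v, hv⟩), fun n => ?_⟩, hs _⟩
  rw [hs, Function.iterate_succ_apply']
  exact hr _

namespace LeavittAlgebra

section

variable {φ : G.LeavittAlgebra R →ₙₐ[R] G.SkewRing R}

theorem coef_map_vertexRep (hφ : ∀ x, φ (.mk G R (G.gen R x)) = G.skewGen R x)
    {y : G.LeavittAlgebra R} {f : V → R} (h : VertexRep y f) (x : G.PathSpace) :
    coef 1 (φ y) x = f (G.src x.1) := by
  induction h with
  | of_p A =>
    rw [p, hφ, skewGen, coef_delta_same]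
    rfl
  | zero => simp
  | add _ _ ihx ihy => rw [map_add, map_add, Pi.add_apply, ihx, ihy, Pi.add_apply]
  | smul c _ ih => rw [map_smul, map_smul, Pi.smul_apply, ih, Pi.smul_apply]

theorem coef_map_s_mul_sStar (hφ : ∀ x, φ (.mk G R (G.gen R x)) = G.skewGen R x) (e : E) :
    coef 1 (φ (s G R e * sStar G R e)) = G.chi R (G.Xt (FreeGroup.of e)) := by
  rw [map_mul, s, sStar, hφ, hφ, skewGen_s_mul_sStar e (chi_Xt_mem (FreeGroup.of_ne_one e)),
    coef_delta_same]
  rfl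

/-- The one place where relation (4) enters injectivity. Equality of images says that `f ∘ s` agrees
on `X` with a function supported on the `X_e`, `e ∈ F`; this forces every vertex in the support of
`f` to be regular, with all its edges in `F`. -/
theorem vertexRep_eq_sum_of_map_eq (hφ : ∀ x, φ (.mk G R (G.gen R x)) = G.skewGen R x)
    {y : G.LeavittAlgebra R} {f : V → R} (hy : VertexRep y f) (F : Finset E)
    (h : φ y = φ (∑ e ∈ F, f (G.s e) • (s G R e * sStar G R e))) :
    y = ∑ e ∈ F, f (G.s e) • (s G R e * sStar G R e) := by
  classical
  have hval (x : G.PathSpace) :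
      f (G.src x.1) = ∑ e ∈ F, f (G.s e) * G.chi R (G.Xt (FreeGroup.of e)) x := by
    rw [← coef_map_vertexRep hφ hy, h]
    simp only [map_sum, map_smul, Finset.sum_apply, coef_map_s_mul_sStar hφ, Pi.smul_apply,
      smul_eq_mul]
  -- Otherwise some `x ∈ X` begins with `e ∉ F`; it lies in no `X_{e'}` with `e' ∈ F`, so the sum at
  -- `x` is zero although `f v` is not.
  have hF (v : V) (hv : f v ≠ 0) (e : E) (he : G.s e = v) : e ∈ F := by
    by_contra heF
    obtain ⟨w, hw⟩ := G.r_nonempty e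
    obtain ⟨z, hz⟩ := exists_src_eq (G := G) w
    obtain ⟨x, hx⟩ : ∃ x : G.PathSpace, x.1 = z.1.cons e :=
      ⟨⟨_, G.isMem_cons.2 ⟨hz ▸ hw, z.2⟩⟩, rfl⟩
    have := hval x
    rw [src_of_eq_cons hx, he] at this
    refine hv (this.trans (Finset.sum_eq_zero fun e' he' => ?_))
    rw [chi_of_notMem, mul_zero]
    intro hmem
    obtain ⟨u, hu⟩ := mem_Xt_of.1 hmem
    exact heF ((RawPath.cons_inj.1 (hx.symm.trans hu)).1 ▸ he')
  -- For a sink `v` the element `([], v)` of `X` has source `v` and lies in no `X_e`.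
  have hsink (v : V) (hv : f v ≠ 0) : ∃ e, G.s e = v := by
    by_contra hs
    push Not at hs
    obtain ⟨x, rfl⟩ := exists_src_eq_of_isSink hs
    refine hv ((hval x).trans (Finset.sum_eq_zero fun e _ => ?_))
    rw [chi_of_notMem, mul_zero]
    intro hmem
    obtain ⟨u, hu⟩ := mem_Xt_of.1 hmem
    exact hs e (src_of_eq_cons hu).symm
  rw [hy.eq_sum (F.image G.s)]
  · rw [← Finset.sum_fiberwise_of_maps_to (t := F.image G.s) (g := G.s)
      fun e he => Finset.mem_image_of_mem _ he]
    refine Finset.sum_congr rfl fun v _ => ?_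
    by_cases hv : f v = 0
    · rw [hv, zero_smul]
      refine (Finset.sum_eq_zero fun e he => ?_).symm
      rw [(Finset.mem_filter.1 he).2, hv, zero_smul]
    -- All edges emitted by `v` lie in the finite set `F`, so relation (4) is available at `v`.
    · have hset : {e | G.s e = v} = ↑(F.filter fun e => G.s e = v) := by
        ext e
        simpa using hF v hv e
      have hfin : {e | G.s e = v}.Finite := hset ▸ Finset.finite_toSet _
      rw [p_singleton (hsink v hv) hfin, Finset.smul_sum]
      refine Finset.sum_congr ?_ fun e he => ?_
      · ext e
        simpa using hF v hv e
      · rw [(Finset.mem_filter.1 he).2]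
  · intro v hv
    by_contra hv'
    obtain ⟨e, he⟩ := hsink v hv'
    exact hv (Finset.mem_image.2 ⟨e, hF v hv' e he, he⟩)

theorem eq_zero_of_mem_diag (hφ : ∀ x, φ (.mk G R (G.gen R x)) = G.skewGen R x) {n : ℕ}
    {x : G.LeavittAlgebra R} (h : x ∈ diag G R n) (hx : φ x = 0) : x = 0 := by
  induction n generalizing x with
  | zero =>
    obtain ⟨f, hf⟩ := exists_vertexRep_iff.1 h
    -- For `F = ∅` the sum is empty and the conclusion reads `x = 0`.
    simpa using vertexRep_eq_sum_of_map_eq hφ hf ∅ (by simpa using hx)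
  | succ n ih =>
    obtain ⟨y, f, hf, z, hz, rfl⟩ := exists_of_mem_diag_succ h
    -- The left side is `s_e^* x s_e`: it lies in the kernel, and in the diagonal one level lower
    -- because all cross terms with other edges vanish.
    have hconj (e : E) : f (G.s e) • p G R ⟨G.r e, .range e⟩ +
        p G R ⟨G.r e, .range e⟩ * z e * p G R ⟨G.r e, .range e⟩ = 0 := by
      have heq : sStar G R e * (y + z.sum fun e w => s G R e * w * sStar G R e) * s G R e =
          f (G.s e) • p G R ⟨G.r e, .range e⟩ +
            p G R ⟨G.r e, .range e⟩ * z e * p G R ⟨G.r e, .range e⟩ := by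
        rw [mul_add, add_mul, hf.conj, Finsupp.sum, Finset.mul_sum, Finset.sum_mul,
          Finset.sum_eq_single e, sStar_mul_conj_mul_s_self]
        · exact fun e' _ hne => sStar_mul_conj_mul_s_of_ne hne.symm _
        · intro he
          rw [Finsupp.notMem_support_iff.1 he]
          simp
      refine ih ?_ ?_
      · obtain ⟨h₁, h₂⟩ := p_mul_mem_diag (hz e) ⟨G.r e, .range e⟩
        refine add_mem (Submodule.smul_mem _ _ ?_) ?_
        · exact diag_zero_le n (exists_vertexRep_iff.2 ⟨_, .of_p _⟩)
        · obtain ⟨h₃, h₄⟩ := p_mul_mem_diag h₁ ⟨G.r e, .range e⟩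
          exact h₄ ▸ h₃
      · rw [← heq, map_mul, map_mul, hx, mul_zero, zero_mul]
    have hterm (e : E) : s G R e * z e * sStar G R e =
        -(f (G.s e) • (s G R e * sStar G R e)) := by
      rw [← conj_p_ran_mul, eq_neg_of_add_eq_zero_right (hconj e), mul_neg, neg_mul,
        mul_smul_comm, smul_mul_assoc, s_mul_p_ran]
    have hsum : (z.sum fun e w => s G R e * w * sStar G R e) =
        -∑ e ∈ z.support, f (G.s e) • (s G R e * sStar G R e) := by
      rw [Finsupp.sum, ← Finset.sum_neg_distrib]
      exact Finset.sum_congr rfl fun e _ => hterm e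
    rw [hsum, ← sub_eq_add_neg] at hx ⊢
    rw [map_sub, sub_eq_zero] at hx
    exact sub_eq_zero.2 (vertexRep_eq_sum_of_map_eq hφ hf _ hx)

end

/-! ### Decomposition into components indexed by the free group -/

variable (G R) in
/-- Left multiplication by `s_a`. -/
noncomputable def mulS : List E → (G.LeavittAlgebra R →ₗ[R] G.LeavittAlgebra R)
  | [] => LinearMap.id
  | e :: a => LinearMap.mulLeft R (s G R e) ∘ₗ mulS a

variable (G R) in
/-- Right multiplication by `s_b^*`. -/
noncomputable def mulSStar : List E → (G.LeavittAlgebra R →ₗ[R] G.LeavittAlgebra R)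
  | [] => LinearMap.id
  | e :: b => LinearMap.mulRight R (sStar G R e) ∘ₗ mulSStar b

theorem mulS_nil (x : G.LeavittAlgebra R) : mulS G R [] x = x := rfl

theorem mulSStar_nil (x : G.LeavittAlgebra R) : mulSStar G R [] x = x := rfl

theorem mulS_cons (e : E) (a : List E) (x : G.LeavittAlgebra R) :
    mulS G R (e :: a) x = s G R e * mulS G R a x := rfl

theorem mulSStar_cons (e : E) (b : List E) (x : G.LeavittAlgebra R) :
    mulSStar G R (e :: b) x = mulSStar G R b x * sStar G R e := rfl

theorem mulS_append (a c : List E) (x : G.LeavittAlgebra R) :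
    mulS G R (a ++ c) x = mulS G R a (mulS G R c x) := by
  induction a with
  | nil => rfl
  | cons e a ih => rw [List.cons_append, mulS_cons, ih, mulS_cons]

theorem mulSStar_append (b c : List E) (x : G.LeavittAlgebra R) :
    mulSStar G R (b ++ c) x = mulSStar G R b (mulSStar G R c x) := by
  induction b with
  | nil => rfl
  | cons e b ih => rw [List.cons_append, mulSStar_cons, ih, mulSStar_cons]

theorem mul_mulSStar (b : List E) (x y : G.LeavittAlgebra R) :
    x * mulSStar G R b y = mulSStar G R b (x * y) := by
  induction b with
  | nil => rfl
  | cons e b ih => rw [mulSStar_cons, mulSStar_cons, ← ih, mul_assoc]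

theorem mulS_mul (a : List E) (x y : G.LeavittAlgebra R) :
    mulS G R a x * y = mulS G R a (x * y) := by
  induction a with
  | nil => rfl
  | cons e a ih => rw [mulS_cons, mulS_cons, ← ih, mul_assoc]

theorem mulS_mulSStar (a b : List E) (x : G.LeavittAlgebra R) :
    mulS G R a (mulSStar G R b x) = mulSStar G R b (mulS G R a x) := by
  induction a with
  | nil => rfl
  | cons e a ih => rw [mulS_cons, mulS_cons, ih, mul_mulSStar]

theorem mulS_mulSStar_self_mem_diag (c : List E) (A : G.GenVertex) :
    mulS G R c (mulSStar G R c (p G R A)) ∈ diag G R c.length := by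
  induction c with
  | nil => exact Submodule.subset_span ⟨A, rfl⟩
  | cons e c ih =>
    rw [mulS_cons, mulSStar_cons, ← mulS_mul, ← mul_assoc]
    exact conjS_mem_diag ih e

theorem diag_le_succ (n : ℕ) : diag G R n ≤ diag G R (n + 1) := by
  induction n with
  | zero => exact diag_zero_le 1
  | succ n ih => exact sup_le_sup le_rfl (iSup_mono fun e => Submodule.map_mono ih)

theorem diag_mono : Monotone (diag G R) := monotone_nat_of_le_succ diag_le_succ

/-- If `a` has a first edge, `p_A` is absorbed by it or kills it; if `a` is empty, `p_A` passes to
the diagonal factor. -/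
theorem exists_p_mul_mulS {n : ℕ} {x : G.LeavittAlgebra R} (hx : x ∈ diag G R n)
    (A : G.GenVertex) (a b : List E) : ∃ y ∈ diag G R n,
      p G R A * mulS G R a (mulSStar G R b x) = mulS G R a (mulSStar G R b y) := by
  cases a with
  | nil => exact ⟨_, (p_mul_mem_diag hx A).1, mul_mulSStar _ _ _⟩
  | cons e a =>
    rw [mulS_cons, ← mul_assoc]
    by_cases hA : G.s e ∈ A.1
    · exact ⟨x, hx, by rw [p_mul_s_of_mem hA, mulS_cons]⟩
    · exact ⟨0, zero_mem _, by rw [p_mul_s_of_notMem hA]; simp⟩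

theorem exists_mulSStar_mul_p {n : ℕ} {x : G.LeavittAlgebra R} (hx : x ∈ diag G R n)
    (A : G.GenVertex) (b : List E) : ∃ y ∈ diag G R n,
      mulSStar G R b x * p G R A = mulSStar G R b y := by
  cases b with
  | nil =>
    obtain ⟨h₁, h₂⟩ := p_mul_mem_diag hx A
    exact ⟨x * p G R A, h₂ ▸ h₁, rfl⟩
  | cons e b =>
    rw [mulSStar_cons, mul_assoc]
    by_cases hA : G.s e ∈ A.1
    · exact ⟨x, hx, by rw [sStar_mul_p_of_mem hA, mulSStar_cons]⟩
    · exact ⟨0, zero_mem _, by rw [sStar_mul_p_of_notMem hA]; simp⟩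

/-- Every element is a combination of words in the generators, and putting a generator in front of
some `s_a p_A s_b^*` gives an element of this form or zero. -/
theorem span_mulS_mulSStar : Submodule.span R
    {x : G.LeavittAlgebra R | ∃ a b A, x = mulS G R a (mulSStar G R b (p G R A))} = ⊤ := by
  set T := Submodule.span R
    {x : G.LeavittAlgebra R | ∃ a b A, x = mulS G R a (mulSStar G R b (p G R A))} with hT
  have hmem (a b : List E) (A : G.GenVertex) : mulS G R a (mulSStar G R b (p G R A)) ∈ T :=
    Submodule.subset_span ⟨a, b, A, rfl⟩
  have hp (B : G.GenVertex) (a b : List E) (A : G.GenVertex) :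
      p G R B * mulS G R a (mulSStar G R b (p G R A)) ∈ T := by
    cases a with
    | nil =>
      rw [mulS_nil, mul_mulSStar, p_mul_p]
      exact hmem [] b _
    | cons e a =>
      rw [mulS_cons, ← mul_assoc]
      by_cases hB : G.s e ∈ B.1
      · rw [p_mul_s_of_mem hB]
        exact hmem (e :: a) b A
      · rw [p_mul_s_of_notMem hB, zero_mul]
        exact zero_mem T
  have hsStar (f : E) (a b : List E) (A : G.GenVertex) :
      sStar G R f * mulS G R a (mulSStar G R b (p G R A)) ∈ T := by
    cases a with
    | nil =>
      rw [mulS_nil, mul_mulSStar]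
      by_cases hA : G.s f ∈ A.1
      -- `s_f^* s_b^* = p_{r(f)} s_{bf}^*`: the star reverses the order, so `f` joins `b` at its
      -- end.
      · rw [sStar_mul_p_of_mem hA, ← p_ran_mul_sStar]
        have := hmem [] (b ++ [f]) ⟨G.r f, .range f⟩
        rwa [mulSStar_append] at this
      · rw [sStar_mul_p_of_notMem hA, map_zero]
        exact zero_mem T
    | cons e a =>
      rw [mulS_cons, ← mul_assoc]
      by_cases hfe : f = e
      · rw [hfe, sStar_mul_s]
        exact hp _ a b A
      · rw [sStar_mul_s_of_ne hfe, zero_mul]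
        exact zero_mem T
  have hgen (g : G.Gen) (a b : List E) (A : G.GenVertex) :
      mk G R (G.gen R g) * mulS G R a (mulSStar G R b (p G R A)) ∈ T := by
    cases g with
    | p B => exact hp B a b A
    | s e => exact hmem (e :: a) b A
    | sStar f => exact hsStar f a b A
  refine Submodule.eq_top_iff'.2 fun x => ?_
  induction x using induction_words with
  | zero => exact zero_mem T
  | add x y hx hy => exact add_mem hx hy
  | smul c x hx => exact T.smul_mem c hx
  | gen g =>
    cases g with
    | p A => exact hmem [] [] A
    | s e =>
      have := hmem [e] [] ⟨G.r e, .range e⟩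
      rwa [mulS_cons, mulSStar_nil, mulS_nil, s_mul_p_ran] at this
    | sStar e =>
      have := hmem [] [e] ⟨G.r e, .range e⟩
      rwa [mulSStar_cons, mulSStar_nil, mulS_nil, p_ran_mul_sStar] at this
  | gen_mul g x hx =>
    induction hx using Submodule.span_induction with
    | mem x hx =>
      obtain ⟨a, b, A, rfl⟩ := hx
      exact hgen g a b A
    | zero => rw [mul_zero]; exact zero_mem T
    | add x y _ _ hx hy => rw [mul_add]; exact add_mem hx hy
    | smul c x _ hx => rw [mul_smul_comm]; exact T.smul_mem c hx

variable (G R) in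
/-- The homogeneous component of degree `t`, spanned by the `s_a p_A s_b^*` with `t = a b⁻¹`. -/
noncomputable def component (t : FreeGroup E) : Submodule R (G.LeavittAlgebra R) :=
  Submodule.span R {x | ∃ a b A, t = word a * (word b)⁻¹ ∧
    x = mulS G R a (mulSStar G R b (p G R A))}

theorem iSup_component : ⨆ t, component G R t = ⊤ := by
  rw [← top_le_iff, ← span_mulS_mulSStar, Submodule.span_le]
  rintro _ ⟨a, b, A, rfl⟩
  exact Submodule.mem_iSup_of_mem _ (Submodule.subset_span ⟨a, b, A, rfl, rfl⟩)

/-- If `a' b'⁻¹ = a b⁻¹` with `a b⁻¹` reduced, then `a' = a c` and `b' = b c`, so `s_{a'} p_A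
s_{b'}^* = s_a (s_c p_A s_c^*) s_b^*` has a diagonal middle factor. -/
theorem exists_of_mem_component {a b : List E} (hr : Red a b) {x : G.LeavittAlgebra R}
    (h : x ∈ component G R (word a * (word b)⁻¹)) :
    ∃ n, ∃ y ∈ diag G R n, x = mulS G R a (mulSStar G R b y) := by
  induction h using Submodule.span_induction with
  | mem x hx =>
    obtain ⟨a', b', A, ht, rfl⟩ := hx
    obtain ⟨c, rfl, rfl⟩ := hr.exists_append ht
    refine ⟨_, _, mulS_mulSStar_self_mem_diag c A, ?_⟩
    rw [mulS_append, mulSStar_append, mulS_mulSStar c b]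
  | zero => exact ⟨0, 0, zero_mem _, by simp⟩
  | add x y _ _ hx hy =>
    obtain ⟨n, x, hx, rfl⟩ := hx
    obtain ⟨m, y, hy, rfl⟩ := hy
    exact ⟨max n m, x + y, add_mem (diag_mono (le_max_left n m) hx)
      (diag_mono (le_max_right n m) hy), by simp⟩
  | smul c x _ hx =>
    obtain ⟨n, x, hx, rfl⟩ := hx
    exact ⟨n, c • x, Submodule.smul_mem _ c hx, by simp⟩

section

variable {φ : G.LeavittAlgebra R →ₙₐ[R] G.SkewRing R}

/-- Cancel one edge: if `φ(w s_e^*) = 0`, multiplying by `s_e` on the right gives `φ(w p_{r(e)}) =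
0`. By induction `w p_{r(e)} = 0`, and so `w s_e^* = w p_{r(e)} s_e^* = 0`. -/
theorem mulSStar_eq_zero (hφ : ∀ x, φ (.mk G R (G.gen R x)) = G.skewGen R x) {n : ℕ}
    {y : G.LeavittAlgebra R} (hy : y ∈ diag G R n) (b : List E)
    (h : φ (mulSStar G R b y) = 0) : mulSStar G R b y = 0 := by
  induction b generalizing y with
  | nil => exact eq_zero_of_mem_diag hφ hy h
  | cons e b ih =>
    obtain ⟨z, hz, hyz⟩ := exists_mulSStar_mul_p hy ⟨G.r e, .range e⟩ b
    have hz0 : mulSStar G R b z = 0 := by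
      refine ih hz ?_
      rw [← hyz, ← sStar_mul_s, ← mul_assoc, map_mul, ← mulSStar_cons, h, zero_mul]
    rw [mulSStar_cons, ← p_ran_mul_sStar, ← mul_assoc, hyz, hz0, zero_mul]

theorem mulS_mulSStar_eq_zero (hφ : ∀ x, φ (.mk G R (G.gen R x)) = G.skewGen R x) {n : ℕ}
    {y : G.LeavittAlgebra R} (hy : y ∈ diag G R n) (a b : List E)
    (h : φ (mulS G R a (mulSStar G R b y)) = 0) : mulS G R a (mulSStar G R b y) = 0 := by
  induction a generalizing y with
  | nil => exact mulSStar_eq_zero hφ hy b h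
  | cons e a ih =>
    obtain ⟨z, hz, hyz⟩ := exists_p_mul_mulS hy ⟨G.r e, .range e⟩ a b
    have hz0 : mulS G R a (mulSStar G R b z) = 0 := by
      refine ih hz ?_
      rw [← hyz, ← sStar_mul_s, mul_assoc, map_mul, ← mulS_cons, h, mul_zero]
    rw [mulS_cons, ← s_mul_p_ran, mul_assoc, hyz, hz0, mul_zero]

theorem eq_zero_of_mem_component (hφ : ∀ x, φ (.mk G R (G.gen R x)) = G.skewGen R x)
    {t : FreeGroup E} {x : G.LeavittAlgebra R} (h : x ∈ component G R t) (hx : φ x = 0) :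
    x = 0 := by
  by_cases ht : ∃ a b : List E, t = word a * (word b)⁻¹
  · obtain ⟨a, b, rfl⟩ := ht
    obtain ⟨a, b, k, rfl, rfl, hr⟩ := exists_red a b
    rw [word_append, word_append,
      show word a * word k * (word b * word k)⁻¹ = word a * (word b)⁻¹ by group] at h
    obtain ⟨n, y, hy, rfl⟩ := exists_of_mem_component hr h
    exact mulS_mulSStar_eq_zero hφ hy a b hx
  · have hbot : component G R t = ⊥ := Submodule.span_eq_bot.2 <| by
      rintro _ ⟨a, b, -, hab, -⟩
      exact absurd ⟨a, b, hab⟩ ht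
    rwa [hbot] at h

theorem map_mem_range_delta (hφ : ∀ x, φ (.mk G R (G.gen R x)) = G.skewGen R x)
    {t : FreeGroup E} {x : G.LeavittAlgebra R} (h : x ∈ component G R t) :
    φ x ∈ LinearMap.range ((G.beta R).delta t) := by
  induction h using Submodule.span_induction with
  | mem x hx =>
    obtain ⟨a, b, A, rfl, rfl⟩ := hx
    have hb : φ (mulSStar G R b (p G R A)) ∈
        LinearMap.range ((G.beta R).delta (word b)⁻¹) := by
      induction b with
      | nil =>
        rw [word_nil, inv_one, mulSStar_nil, p, hφ]
        exact ⟨_, rfl⟩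
      | cons e b ih =>
        obtain ⟨c, hc⟩ := ih
        rw [word_cons, mul_inv_rev, mulSStar_cons, map_mul, ← hc, sStar, hφ]
        exact ⟨_, (AlgPartialAction.delta_mul_delta _ _ _ _ _).symm⟩
    induction a with
    | nil =>
      rw [word_nil, one_mul]
      exact hb
    | cons e a ih =>
      obtain ⟨c, hc⟩ := ih
      rw [word_cons, mul_assoc, mulS_cons, map_mul, ← hc, s, hφ]
      exact ⟨_, (AlgPartialAction.delta_mul_delta _ _ _ _ _).symm⟩
  | zero => rw [map_zero]; exact zero_mem _
  | add x y _ _ hx hy => rw [map_add]; exact add_mem hx hy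
  | smul c x _ hx => rw [map_smul]; exact Submodule.smul_mem _ c hx

/-- Components of different index land in different degrees, so each lies in the kernel and is zero.
Directness of the sum of components is not needed beforehand. -/
theorem injective_of_skewGen (hφ : ∀ x, φ (.mk G R (G.gen R x)) = G.skewGen R x) :
    Function.Injective φ := by
  refine (injective_iff_map_eq_zero φ).2 fun x hx => ?_
  have hmem : x ∈ ⨆ t, component G R t := iSup_component (G := G) (R := R) ▸ Submodule.mem_top
  obtain ⟨f, hf, rfl⟩ := (Submodule.mem_iSup_iff_exists_finsupp _ _).1 hmem
  refine Finset.sum_eq_zero fun t _ => eq_zero_of_mem_component hφ (hf t) ?_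
  choose c hc using fun t => map_mem_range_delta hφ (hf t)
  have hcoef := congrArg (coef t) hx
  rw [Finsupp.sum, map_sum, map_sum, map_zero, Finset.sum_eq_single t] at hcoef
  · rw [← hc, coef_delta_same] at hcoef
    rw [← hc, show c t = 0 from beta_ext hcoef, map_zero]
  · intro s _ hs
    rw [← hc, coef_delta_ne hs]
  · intro ht
    rw [Finsupp.notMem_support_iff.1 ht, map_zero, map_zero]

end

end LeavittAlgebra

end Ultragraph

/-! ### The isomorphism -/

theorem theorem3 {V : Type u} {E : Type v} [Countable V] [Countable E] (G : Ultragraph V E)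
    (R : Type w) [CommRing R] :
    ∃ φ : G.LeavittAlgebra R →ₙₐ[R] G.SkewRing R,
      Function.Bijective φ ∧
      (∀ A : G.GenVertex, φ (.p G R A) = (G.beta R).delta 1 (G.oneA R A)) ∧
      (∀ e : E, φ (.s G R e) =
        (G.beta R).delta (FreeGroup.of e) (G.oneT R (FreeGroup.of e) (FreeGroup.of_ne_one e))) ∧
      (∀ e : E, φ (.sStar G R e) =
        (G.beta R).delta (FreeGroup.of e)⁻¹
          (G.oneT R (FreeGroup.of e)⁻¹ (inv_ne_one.2 (FreeGroup.of_ne_one e)))) := by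
  obtain ⟨φ, hφ⟩ := Ultragraph.exists_hom_skewGen G R
  exact ⟨φ, ⟨Ultragraph.LeavittAlgebra.injective_of_skewGen hφ, Ultragraph.surjective_of_skewGen hφ⟩,
    fun A => hφ (.p A), fun e => hφ (.s e), fun e => hφ (.sStar e)⟩
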